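/- **Setting.** Let $\mathbb{X}$ be a finite alphabet with $D$ elements and let $(X_i)_{i\in\mathbb{Z}}$ be a stochastic process on a probability space with values in $\mathbb{X}$; write $X_{t+1}^{t+n}=(X_{t+1},\dots,X_{t+n})$. The process is called *finite-energy* if there are constants $c<1$ and $K$ such that $P(X_{t+|w|+1}^{t+|w|+|u|}=u\mid X_{t+1}^{t+|w|}=w)\le Kc^{|u|}$ for all $t\in\mathbb{Z}$ and all strings $u,w$ over $\mathbb{X}$ with $P(X_{t+1}^{t+|w|}=w)>0$. It is called *strongly nonergodic* if there are IID binary random variables $(Z_k)_{k\in\mathbb{N}}$ on the same probability space with $P(Z_k=0)=P(Z_k=1)=\frac12$ and functions $s_k:\mathbb{X}^*\to\{0,1\}$ such that $\lim_{n\to\infty}P(s_k(X_{t+1}^{t+n})=Z_k)=1$ for all $t\in\mathbb{Z}$ and $k\in\mathbb{N}$. For such $Z_k$, $s_k$ and for $\delta\in(\frac12,1)$ let $U_\delta(n)=\{k\in\mathbb{N}:P(s_k(X_1^n)=Z_k)\ge\delta\}$. An *admissible grammar* is a list of rules $A_1\to\alpha_1,\dots,A_m\to\alpha_m$ ($m\ge1$)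 with start symbol $A_1$ and $\alpha_i\in(\{A_{i+1},\dots,A_m\}\cup\mathbb{X})^*$, regarded as a context-free grammar; its *vocabulary size* is $\mathbf{V}[G]=m$. A *grammar transform* is a function $\Gamma$ that assigns to each nonempty string $w$ over $\mathbb{X}$ an admissible grammar $\Gamma(w)$ that generates the language $\{w\}$. Let $B_S:\{0,1,2,\dots\}\to\{0,1\}^*$ be a code such that no $B_S(m)$ is a prefix of $B_S(n)$ for $m\ne n$, $|B_S(n)|$ is nondecreasing in $n$, and $\limsup_{n\to\infty}|B_S(n)|/\log_2 n=1$, and identify $\mathbb{X}$ with $\{0,\dots,D-1\}$ by some numbering. Encode a grammar $G$ by the sequence of numbers $F_1(\alpha_1)\,D\,F_2(\alpha_2)\,D\cdots D\,F_m(\alpha_m)\,(D+1)$, where $F_i$ acts symbol by symbol by $F_i(x)=x$ for $x\in\mathbb{X}$ and $F_i(A_j)=D+1+j-i$, and let $\|G\|$ be the length of the binary string obtained from this sequence by replacing each number $n$ with $B_S(n)$. A grammar transform $\Gamma$ is *admissibly minimal* if, for some such $B_S$ and some such numbering of $\mathbb{X}$, one has $\|\Gamma(w)\|\le\|G\|$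 for every nonempty string $w$ and every admissible grammar $G$ generating $\{w\}$. **Theorem.** Let $(X_i)_{i\in\mathbb{Z}}$ be a stationary, finite-energy, strongly nonergodic process over a finite alphabet $\mathbb{X}$, with $Z_k$, $s_k$ as in the definition of strong nonergodicity. If $$\liminf_{n\to\infty}\frac{\operatorname{card}U_\delta(n)}{n^\beta}>0$$ for some $\beta\in(0,1)$ and some $\delta\in(\frac12,1)$, then $$\limsup_{n\to\infty}\,\mathbf{E}_P\left(\frac{\mathbf{V}[\Gamma(X_1^n)]}{n^\beta(\log n)^{-1}}\right)^p>0$$ for every $p>1$ and every admissibly minimal grammar transform $\Gamma$. -/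

import Mathlib

open MeasureTheory ProbabilityTheory Filter Topology
open scoped ENNReal

/-- An admissible grammar over the alphabet `α`, given by its ordered list of production rules
`A₁ → α₁, …, Aₘ → αₘ` with `αᵢ ∈ ({Aᵢ₊₁, …, Aₘ} ∪ α)*`. Exactly one rule per nonterminal; the
nonterminals are indexed by `Fin m` with `m = vocab ≥ 1`, and index `0` is the start symbol. -/
structure AdmissibleGrammar (α : Type*) where
  /-- The number of nonterminal symbols, i.e. the vocabulary size. -/
  vocab : ℕ
  vocab_pos : 0 < vocab
  /-- The right-hand sides of the rules. -/
  rhs : Fin vocab → List (Symbol α (Fin vocab))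
  acyclic : ∀ i j, Symbol.nonterminal j ∈ rhs i → i < j

namespace AdmissibleGrammar

variable {α : Type*}

/-- The context-free grammar presented by the rules, with start symbol `A₁`. -/
noncomputable def toCFG (G : AdmissibleGrammar α) : ContextFreeGrammar α where
  NT := Fin G.vocab
  initial := ⟨0, G.vocab_pos⟩
  rules := by
    classical
    exact Finset.univ.image fun i : Fin G.vocab => ⟨i, G.rhs i⟩

theorem mem_rules (G : AdmissibleGrammar α) (r : ContextFreeRule α (Fin G.vocab)) :
    r ∈ G.toCFG.rules ↔ ∃ i, ⟨i, G.rhs i⟩ = r := by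
  classical
  exact Finset.mem_image.trans (by simp)

/-- The grammar generates the singleton language `{w}`. -/
def GeneratesOnly (G : AdmissibleGrammar α) (w : List α) : Prop :=
  G.toCFG.language = {w}

/-- The string over `α` obtained by completely rewriting the nonterminal of index `i`. -/
def expand (G : AdmissibleGrammar α) (i : Fin G.vocab) : List α :=
  (G.rhs i).attach.flatMap fun
    | ⟨Symbol.terminal a, _⟩ => [a]
    | ⟨Symbol.nonterminal j, _⟩ => G.expand j
termination_by G.vocab - i.val
decreasing_by
  have h := G.acyclic i j (by assumption)
  have := j.isLt
  have : i.val < j.val := h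
  omega

/-- The string over `α` obtained by completely rewriting a single symbol. -/
def expandSymbol (G : AdmissibleGrammar α) : Symbol α (Fin G.vocab) → List α
  | Symbol.terminal a => [a]
  | Symbol.nonterminal j => G.expand j

theorem expand_eq (G : AdmissibleGrammar α) (i : Fin G.vocab) :
    G.expand i = (G.rhs i).flatMap G.expandSymbol := by
  rw [expand]
  conv_rhs => rw [← List.attach_map_subtype_val (G.rhs i), List.flatMap_map]
  congr 1
  funext x
  rcases x with ⟨_ | _, _⟩ <;> rfl

theorem flatMap_expandSymbol_of_derives (G : AdmissibleGrammar α)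
    {u v : List (Symbol α (Fin G.vocab))} (h : G.toCFG.Derives u v) :
    u.flatMap G.expandSymbol = v.flatMap G.expandSymbol := by
  have key : ∀ (p q : List (Symbol α (Fin G.vocab))) (i : Fin G.vocab),
      (p ++ [Symbol.nonterminal i] ++ q).flatMap G.expandSymbol =
        (p ++ G.rhs i ++ q).flatMap G.expandSymbol := by
    intro p q i
    simp [expandSymbol, ← G.expand_eq i]
  induction h with
  | refl => rfl
  | tail _ h ih =>
    rw [ih]
    obtain ⟨r, hr, hrw⟩ := h
    obtain ⟨i, rfl⟩ := (G.mem_rules r).1 hr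
    obtain ⟨p, q, rfl, rfl⟩ := hrw.exists_parts
    exact key p q i

theorem derives_expand_of (G : AdmissibleGrammar α) (l : List (Symbol α (Fin G.vocab)))
    (h : ∀ j, Symbol.nonterminal j ∈ l →
      G.toCFG.Derives [Symbol.nonterminal j] ((G.expand j).map Symbol.terminal)) :
    G.toCFG.Derives l ((l.flatMap G.expandSymbol).map Symbol.terminal) := by
  induction l with
  | nil => exact ContextFreeGrammar.Derives.refl _
  | cons x l ih =>
    have h1 := ih fun j hj => h j (List.mem_cons_of_mem _ hj)
    have h2 : G.toCFG.Derives [x] ((G.expandSymbol x).map Symbol.terminal) := by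
      cases x with
      | terminal a => exact ContextFreeGrammar.Derives.refl _
      | nonterminal j => exact h j List.mem_cons_self
    rw [List.flatMap_cons, List.map_append]
    exact (h2.append_right l).trans (h1.append_left _)

theorem derives_expand (G : AdmissibleGrammar α) (i : Fin G.vocab) :
    G.toCFG.Derives [Symbol.nonterminal i] ((G.expand i).map Symbol.terminal) := by
  have hp : G.toCFG.Produces [Symbol.nonterminal i] (G.rhs i) :=
    ⟨⟨i, G.rhs i⟩, (G.mem_rules _).2 ⟨i, rfl⟩,
      ContextFreeRule.Rewrites.input_output (r := ⟨i, G.rhs i⟩)⟩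
  rw [G.expand_eq i]
  exact hp.trans_derives (G.derives_expand_of _ fun j hj => G.derives_expand j)
termination_by G.vocab - i.val
decreasing_by
  have h : i.val < j.val := G.acyclic i j hj
  have := j.isLt
  omega

theorem language_toCFG (G : AdmissibleGrammar α) :
    G.toCFG.language = {G.expand ⟨0, G.vocab_pos⟩} := by
  ext w
  rw [ContextFreeGrammar.mem_language_iff]
  constructor
  · intro h
    have h' := G.flatMap_expandSymbol_of_derives h
    have e : (w.map Symbol.terminal).flatMap G.expandSymbol = w := by
      rw [List.flatMap_map]
      exact List.flatMap_singleton' w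
    exact (e.symm.trans h'.symm).trans (List.append_nil _)
  · rintro rfl
    exact G.derives_expand _

theorem generatesOnly_iff (G : AdmissibleGrammar α) (w : List α) :
    G.GeneratesOnly w ↔ G.expand ⟨0, G.vocab_pos⟩ = w := by
  rw [GeneratesOnly, language_toCFG]
  exact Set.singleton_eq_singleton_iff

variable [Fintype α]

/-- The natural number that stands for a symbol on the right-hand side of the `i`-th rule. Terminals
are numbered `0, …, D - 1` by `e`, where `D` is the alphabet size, and the nonterminal `Aⱼ` is
represented by `D + 1 + j - i` (relative indexing). -/
def symbolNumber {m : ℕ} (e : α ≃ Fin (Fintype.card α)) (i : Fin m) : Symbol α (Fin m) → ℕ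
  | Symbol.terminal a => (e a : ℕ)
  | Symbol.nonterminal j => Fintype.card α + 1 + (j.val - i.val)

/-- A grammar as a string of natural numbers: the encoded right-hand sides, separated by the number
`D` and terminated by the number `D + 1`. -/
def toNumbers (e : α ≃ Fin (Fintype.card α)) (G : AdmissibleGrammar α) : List ℕ :=
  [Fintype.card α].intercalate (List.ofFn fun i => (G.rhs i).map (symbolNumber e i))
    ++ [Fintype.card α + 1]

/-- The binary encoding of a grammar obtained from a code `b` for the natural numbers. -/
def encode (e : α ≃ Fin (Fintype.card α)) (b : ℕ → List Bool) (G : AdmissibleGrammar α) :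
    List Bool :=
  (G.toNumbers e).flatMap b

/-- The length `‖G‖` of the binary encoding of a grammar. -/
def codeLength (e : α ≃ Fin (Fintype.card α)) (b : ℕ → List Bool) (G : AdmissibleGrammar α) : ℕ :=
  (G.encode e b).length

end AdmissibleGrammar

/-- A binary code for the natural numbers `0, 1, 2, …`: prefix-free (hence injective), with
nondecreasing code lengths, asymptotically of length `log₂ n`. -/
structure IsNaturalNumberCode (b : ℕ → List Bool) : Prop where
  prefixFree : ∀ m n, b m <+: b n → m = n
  monotone_length : Monotone fun n => (b n).length
  limsup_length :
    limsup (fun n : ℕ => ((b n).length : ℝ≥0∞) / ENNReal.ofReal (Real.logb 2 n)) atTop = 1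

/-- `Γ` is a grammar transform: `Γ w` generates exactly `{w}`, for each nonempty string `w`. -/
def IsGrammarTransform {α : Type*} (Γ : List α → AdmissibleGrammar α) : Prop :=
  ∀ w, w ≠ [] → (Γ w).GeneratesOnly w

/-- `Γ` is an admissibly minimal grammar transform: for some natural number code and some numbering
of the alphabet, `Γ w` has the shortest encoding among all admissible grammars generating `{w}`,
for each nonempty string `w`. -/
def IsAdmissiblyMinimal {α : Type*} [Fintype α] (Γ : List α → AdmissibleGrammar α) : Prop :=
  IsGrammarTransform Γ ∧
    ∃ (e : α ≃ Fin (Fintype.card α)) (b : ℕ → List Bool), IsNaturalNumberCode b ∧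
      ∀ w, w ≠ [] → ∀ G : AdmissibleGrammar α, G.GeneratesOnly w →
        (Γ w).codeLength e b ≤ G.codeLength e b

section Stochastic

variable {Ω α : Type*}

/-- The block `X_{t+1}, …, X_{t+n}` of a process, as a string. -/
def block (X : ℤ → Ω → α) (t : ℤ) (n : ℕ) (ω : Ω) : List α :=
  List.ofFn fun i : Fin n => X (t + 1 + (i.val : ℤ)) ω

variable [MeasurableSpace Ω]

/-- Stationarity: the law of the process is invariant under the shift. -/
def IsStationaryProcess [MeasurableSpace α] (P : Measure Ω) (X : ℤ → Ω → α) : Prop :=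
  P.map (fun ω (i : ℤ) => X (i + 1) ω) = P.map (fun ω (i : ℤ) => X i ω)

/-- Finite-energy process: the conditional probability of a string `u` right after a string `w` of
positive probability is at most `K * c ^ |u|`, with constants `c < 1` and `K`. -/
def IsFiniteEnergy (P : Measure Ω) (X : ℤ → Ω → α) : Prop :=
  ∃ c K : ℝ, c < 1 ∧ ∀ (t : ℤ) (u w : List α), 0 < P {ω | block X t w.length ω = w} →
    (cond P {ω | block X t w.length ω = w}).real
      {ω | block X (t + w.length) u.length ω = u} ≤ K * c ^ u.length

/-- The binary variables `Z k` (the facts) and the functions `s k` witness that the process `X` is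
strongly nonergodic: the `Z k` are IID, equidistributed, and each `Z k` is predicted by `s k` from
`X_{t+1}, …, X_{t+n}` with probability tending to one as `n → ∞`, for every `t`. The countably many
facts are indexed by `k = 0, 1, 2, …`. -/
structure IsStronglyNonergodicWith (P : Measure Ω) (X : ℤ → Ω → α) (Z : ℕ → Ω → Bool)
    (s : ℕ → List α → Bool) : Prop where
  measurable : ∀ k, Measurable (Z k)
  indep : iIndepFun Z P
  prob_false : ∀ k, P {ω | Z k ω = false} = 1 / 2
  prob_true : ∀ k, P {ω | Z k ω = true} = 1 / 2
  predictable : ∀ (t : ℤ) (k : ℕ),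
    Tendsto (fun n : ℕ => P {ω | s k (block X t n ω) = Z k ω}) atTop (𝓝 1)

/-- The set `U_δ(n)` of facts predicted from `X_1, …, X_n` with probability at least `δ`. -/
def predictableFacts (P : Measure Ω) (X : ℤ → Ω → α) (Z : ℕ → Ω → Bool) (s : ℕ → List α → Bool)
    (δ : ℝ) (n : ℕ) : Set ℕ :=
  {k | δ ≤ P.real {ω | s k (block X 0 n ω) = Z k ω}}

end Stochastic

/-! The length of the minimal grammar's binary code is squeezed between two estimates that disagree
if the vocabulary is small. Write `C(n)` for the expected code length of `X_1^n` and, for a finite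
set `F` of facts predictable from `X_1^n`, write `H` for the entropy of `X_1^n` given `Z_k`, `k ∈
F`, in nats.

Lower bound (`entropyGiven_add_le`). The code is prefix-free, so Kraft's inequality turns it into a
subprobability on strings. Multiplied by a guess at each fact with odds `δ` to `1 - δ`, it becomes a
subprobability on strings and facts jointly. Gibbs' inequality yields `C(n) log 2 ≥ H + |F| (log 2 -
h(δ))`, where `h(δ) < log 2` is the binary entropy.

Upper bound. A grammar of `uv` can be cut into a grammar of `u` and one of `v`. A nonterminal whose
expansion occurs only once is cut along with the string. A repeated one is kept in both halves and
is spelled out where the cut goes through it. The cost per rule is one reference plus the length of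
the longest repeat, which finite energy makes logarithmic with high probability
(`measureReal_exists_long_repeat_le`). Hence `2 C(n) ≤ C(2n) + O(log n) E V(2n) + O(1)`.

If the limsup vanished, `log n · E V(n)` would be `o(n^β)`. Since `β < 1`, the errors telescope
along doublings to `C(n) ≤ C(2^k n) / 2^k + o(n^β)`. A grammar that encodes long strings by a
dictionary of block sequences, ranked by conditional probability given the facts, shows that `log 2
· C(2^k n) / 2^k` is at most `H` in the limit (`codeLength_le_entropyGiven`). This uses that the
facts are tail-like: their joint law with a window does not depend on where the window lies.

Together, `|F| (log 2 - h(δ)) = o(n^β)`, against `|F| ≥ c n^β`. -/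

/-! ### Prefix-freeness of the grammar code and Kraft's inequality. -/

theorem List.sum_map_intercalate {β : Type*} (f : β → ℕ) (sep : List β) (ls : List (List β)) :
    ((sep.intercalate ls).map f).sum =
      (ls.map fun l => (l.map f).sum).sum + (ls.length - 1) * (sep.map f).sum := by
  induction ls with
  | nil => simp
  | cons l ls ih =>
    cases ls with
    | nil => simp
    | cons l' ls =>
      rw [List.intercalate_cons_cons]
      simp only [List.map_append, List.sum_append, ih, List.map_cons, List.sum_cons,
        List.length_cons]
      simp only [Nat.add_sub_cancel]
      ring

theorem List.mem_or_exists_mem_of_mem_intercalate {β : Type*} {x : β} {sep : List β}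
    {ls : List (List β)} (h : x ∈ sep.intercalate ls) : x ∈ sep ∨ ∃ l ∈ ls, x ∈ l := by
  induction ls with
  | nil => simp at h
  | cons l ls ih =>
    cases ls with
    | nil => exact Or.inr ⟨l, by simp_all⟩
    | cons l' ls =>
      rw [List.intercalate_cons_cons, List.mem_append, List.mem_append] at h
      rcases h with (h | h) | h
      · exact Or.inr ⟨l, List.mem_cons_self, h⟩
      · exact Or.inl h
      · rcases ih h with h | ⟨l'', h1, h2⟩
        · exact Or.inl h
        · exact Or.inr ⟨l'', List.mem_cons_of_mem _ h1, h2⟩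

namespace IsNaturalNumberCode

variable {b : ℕ → List Bool}

theorem length_pos (hb : IsNaturalNumberCode b) (n : ℕ) : 0 < (b n).length := by
  rw [List.length_pos_iff]
  intro h
  have h1 := hb.prefixFree n (n + 1) (by rw [h]; exact List.nil_prefix)
  omega

/-- Sequences of numbers that end with their only occurrence of `t` have a prefix-free encoding. -/
theorem eq_of_flatMap_prefix (hb : IsNaturalNumberCode b) (t : ℕ) :
    ∀ {l l' : List ℕ}, t ∉ l → t ∉ l' → (l ++ [t]).flatMap b <+: (l' ++ [t]).flatMap b → l = l' := by
  -- Two code words that begin the same string are comparable for the prefix order, hence equal.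
  have head : ∀ {x y : ℕ} {r r' : List Bool}, b x ++ r <+: b y ++ r' → x = y := by
    intro x y r r' h
    have h1 : b x <+: b y ++ r' := (List.prefix_append _ _).trans h
    have h2 : b y <+: b y ++ r' := List.prefix_append _ _
    rcases le_total (b x).length (b y).length with h3 | h3
    · exact hb.prefixFree _ _ (List.prefix_of_prefix_length_le h1 h2 h3)
    · exact (hb.prefixFree _ _ (List.prefix_of_prefix_length_le h2 h1 h3)).symm
  intro l
  induction l with
  | nil =>
    intro l' _ h' h
    cases l' with
    | nil => rfl
    | cons y l' =>
      have := head (r := []) (by simpa [List.flatMap_append] using h)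
      simp [this] at h'
  | cons x l ih =>
    intro l' h0 h' h
    cases l' with
    | nil =>
      simp only [List.cons_append, List.flatMap_cons, List.nil_append] at h
      have := head h
      simp [this] at h0
    | cons y l' =>
      simp only [List.cons_append, List.flatMap_cons] at h
      obtain rfl := head h
      rw [ih (by simp_all) (by simp_all) ((List.prefix_append_right_inj _).1 h)]

/-- Code lengths are at most `(1 + ε) log₂ n` up to an additive constant. -/
theorem exists_length_le (hb : IsNaturalNumberCode b) (D : ℕ) {ε : ℝ} (hε : 0 < ε) :
    ∃ C : ℝ, 0 ≤ C ∧ ∀ x : ℕ, 1 ≤ x →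
      ((b (D + x)).length : ℝ) * Real.log 2 ≤ (1 + ε) * Real.log x + C := by
  have h1 : limsup (fun n : ℕ => ((b n).length : ℝ≥0∞) / ENNReal.ofReal (Real.logb 2 n)) atTop
      < ENNReal.ofReal (1 + ε) := by
    rw [hb.limsup_length]
    exact ENNReal.one_lt_ofReal.2 (by linarith)
  have h2 := eventually_lt_of_limsup_lt h1
  obtain ⟨N, hN⟩ := eventually_atTop.1 h2
  have hlog2 : 0 < Real.log 2 := Real.log_pos (by norm_num)
  have hbig : ∀ n : ℕ, N ≤ n → 2 ≤ n → ((b n).length : ℝ) * Real.log 2 ≤ (1 + ε) * Real.log n := by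
    intro n hn hn2
    have hn2' : (2 : ℝ) ≤ n := by exact_mod_cast hn2
    have hlogn : 0 < Real.log n := Real.log_pos (by linarith)
    have hl : 0 < Real.logb 2 n := div_pos hlogn hlog2
    have h := (hN n hn).le
    rw [ENNReal.div_le_iff (by simpa using hl) (by simp), ← ENNReal.ofReal_mul (by linarith),
      ← ENNReal.ofReal_natCast, ENNReal.ofReal_le_ofReal_iff (by positivity)] at h
    calc ((b n).length : ℝ) * Real.log 2 ≤ (1 + ε) * Real.logb 2 n * Real.log 2 := by gcongr
      _ = (1 + ε) * Real.log n := by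
        rw [Real.logb]; field_simp
  -- Up to `M` monotonicity bounds the lengths by that of `b M`; beyond `M` the limsup bound
  -- applies, with `D + x ≤ (D + 1) x`. The 2 keeps the logarithm positive.
  set M := max N 2
  refine ⟨(b M).length * Real.log 2 + (1 + ε) * Real.log (D + 1), ?_, ?_⟩
  · have : 0 ≤ Real.log ((D : ℝ) + 1) := Real.log_nonneg (by linarith [(Nat.cast_nonneg D : (0:ℝ) ≤ D)])
    positivity
  · intro x hx
    have hx' : (1 : ℝ) ≤ x := by exact_mod_cast hx
    have hD : (0 : ℝ) ≤ D := Nat.cast_nonneg D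
    have h3 : 0 ≤ Real.log x := Real.log_nonneg hx'
    have h4 : 0 ≤ Real.log ((D : ℝ) + 1) := Real.log_nonneg (by linarith)
    rcases le_total (D + x) M with h | h
    · have h5 : ((b (D + x)).length : ℝ) ≤ (b M).length := by exact_mod_cast hb.monotone_length h
      have h6 : 0 ≤ (1 + ε) * Real.log x := by positivity
      have h7 : 0 ≤ (1 + ε) * Real.log ((D : ℝ) + 1) := by positivity
      have := mul_le_mul_of_nonneg_right h5 hlog2.le
      linarith
    · have h5 := hbig (D + x) (le_trans (le_max_left _ _) h) (le_trans (le_max_right _ _) h)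
      have h6 : Real.log ((D + x : ℕ) : ℝ) ≤ Real.log x + Real.log ((D : ℝ) + 1) := by
        rw [← Real.log_mul (by positivity) (by positivity)]
        apply Real.log_le_log
        · push_cast; linarith
        · push_cast; nlinarith
      have h7 : (1 + ε) * Real.log ((D + x : ℕ) : ℝ) ≤
          (1 + ε) * (Real.log x + Real.log ((D : ℝ) + 1)) := by gcongr
      have h8 : 0 ≤ ((b M).length : ℝ) * Real.log 2 := by positivity
      linarith

end IsNaturalNumberCode

namespace AdmissibleGrammar

variable {α : Type*} [Fintype α]

/-- The length of the binary encoding of a string of symbols standing in the `i`-th rule. -/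
def symbolsLength (e : α ≃ Fin (Fintype.card α)) (b : ℕ → List Bool) {m : ℕ} (i : Fin m)
    (l : List (Symbol α (Fin m))) : ℕ :=
  (l.map fun x => (b (symbolNumber e i x)).length).sum

theorem codeLength_eq (e : α ≃ Fin (Fintype.card α)) (b : ℕ → List Bool)
    (G : AdmissibleGrammar α) :
    G.codeLength e b = ∑ i, symbolsLength e b i (G.rhs i)
      + (G.vocab - 1) * (b (Fintype.card α)).length + (b (Fintype.card α + 1)).length := by
  unfold codeLength encode toNumbers
  rw [List.length_flatMap, List.map_append, List.sum_append,
    List.sum_map_intercalate (fun n => (b n).length)]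
  simp [symbolsLength, List.sum_ofFn, List.map_ofFn, Function.comp_def, List.map_map]

theorem symbolNumber_ne_card (e : α ≃ Fin (Fintype.card α)) {m : ℕ} (i : Fin m)
    (x : Symbol α (Fin m)) : symbolNumber e i x ≠ Fintype.card α := by
  cases x with
  | terminal a => exact (e a).isLt.ne
  | nonterminal j => simp only [symbolNumber]; omega

theorem symbolNumber_ne_card_succ (e : α ≃ Fin (Fintype.card α)) (G : AdmissibleGrammar α)
    {i : Fin G.vocab} {x : Symbol α (Fin G.vocab)} (hx : x ∈ G.rhs i) :
    symbolNumber e i x ≠ Fintype.card α + 1 := by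
  cases x with
  | terminal a =>
    have := (e a).isLt
    simp only [symbolNumber]; omega
  | nonterminal j =>
    have : i.val < j.val := G.acyclic i j hx
    simp only [symbolNumber]; omega

/-- Terminals are numbered below `D` and nonterminals above it, so `D` occurs only as a separator
and splitting at `D` recovers the rules. The truncated difference `j - i` determines `j` because
acyclicity forces `i < j`. -/
theorem toNumbers_injective (e : α ≃ Fin (Fintype.card α)) :
    Function.Injective (toNumbers (α := α) e) := by
  rintro G G' h
  unfold toNumbers at h
  have h1 := List.append_cancel_right h
  have aux : ∀ H : AdmissibleGrammar α, ([Fintype.card α].intercalate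
      (List.ofFn fun i => (H.rhs i).map (symbolNumber e i))).splitOn (Fintype.card α) =
      List.ofFn fun i => (H.rhs i).map (symbolNumber e i) := by
    intro H
    apply List.splitOn_intercalate
    · intro l hl
      obtain ⟨i, rfl⟩ := (List.mem_ofFn' _ _).1 hl
      rw [List.mem_map]
      rintro ⟨x, _, hx⟩
      exact symbolNumber_ne_card e i x hx
    · intro h0
      have := congrArg List.length h0
      have := H.vocab_pos
      simp at *
      omega
  have h2 := congrArg (List.splitOn (Fintype.card α)) h1
  rw [aux, aux] at h2
  obtain ⟨m, hm, r, hr⟩ := G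
  obtain ⟨m', hm', r', hr'⟩ := G'
  have hmm : m = m' := by simpa using congrArg List.length h2
  subst hmm
  have h3 := List.ofFn_injective h2
  have h4 : r = r' := by
    funext i
    have h5 : (r i).map (symbolNumber e i) = (r' i).map (symbolNumber e i) := congrFun h3 i
    have key : ∀ l l' : List (Symbol α (Fin m)), (∀ j, Symbol.nonterminal j ∈ l → i < j) →
        (∀ j, Symbol.nonterminal j ∈ l' → i < j) →
        l.map (symbolNumber e i) = l'.map (symbolNumber e i) → l = l' := by
      intro l
      induction l with
      | nil => intro l' _ _ h; exact (List.map_eq_nil_iff.1 h.symm).symm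
      | cons x l ih =>
        intro l' hl hl' h
        cases l' with
        | nil => simp at h
        | cons y l' =>
          simp only [List.map_cons, List.cons.injEq] at h
          rw [ih l' (fun j hj => hl j (List.mem_cons_of_mem _ hj))
            (fun j hj => hl' j (List.mem_cons_of_mem _ hj)) h.2]
          have h6 := h.1
          congr 1
          cases x with
          | terminal a =>
            have := (e a).isLt
            cases y with
            | terminal a' => exact congrArg _ (e.injective (Fin.ext h6))
            | nonterminal j' => simp only [symbolNumber] at h6; omega
          | nonterminal j =>
            cases y with
            | terminal a' =>
              have := (e a').isLt
              simp only [symbolNumber] at h6; omega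
            | nonterminal j' =>
              have e1 : i.val < j.val := hl j List.mem_cons_self
              have e2 : i.val < j'.val := hl' j' List.mem_cons_self
              simp only [symbolNumber] at h6
              congr 1
              apply Fin.ext
              omega
    exact key _ _ (hr i) (hr' i) h5
  subst h4
  rfl

/-- Since `j - i ≥ 1` in a rule, nonterminals are numbered at least `D + 2`. So `D + 1` occurs only
as the end mark, which makes the encoding of whole grammars prefix-free. -/
theorem eq_of_encode_prefix {e : α ≃ Fin (Fintype.card α)} {b : ℕ → List Bool}
    (hb : IsNaturalNumberCode b) {G G' : AdmissibleGrammar α}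
    (h : G.encode e b <+: G'.encode e b) : G = G' := by
  have aux : ∀ H : AdmissibleGrammar α, Fintype.card α + 1 ∉ [Fintype.card α].intercalate
      (List.ofFn fun i => (H.rhs i).map (symbolNumber e i)) := by
    intro H hmem
    rcases List.mem_or_exists_mem_of_mem_intercalate hmem with hl | ⟨l, hl, hmem⟩
    · simp at hl
    · obtain ⟨i, rfl⟩ := (List.mem_ofFn' _ _).1 hl
      obtain ⟨x, hx, hx'⟩ := List.mem_map.1 hmem
      exact symbolNumber_ne_card_succ e H hx hx'
  apply toNumbers_injective e
  unfold toNumbers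
  rw [hb.eq_of_flatMap_prefix _ (aux G) (aux G') h]

end AdmissibleGrammar

/-- **Kraft's inequality** for prefix-free families of nonempty binary strings. -/
theorem sum_two_inv_pow_length_le_one {ι : Type*} [Fintype ι] (f : ι → List Bool)
    (hf : ∀ i j, f i <+: f j → i = j) (hne : ∀ i, f i ≠ []) :
    ∑ i, (2⁻¹ : ℝ) ^ (f i).length ≤ 1 := by
  classical
  have hinj : Function.Injective f := fun i j h => hf i j (h ▸ List.prefix_rfl)
  -- Decoding peels off first words: prefix-freeness identifies them, and nonemptiness excludes that
  -- one factorization stops early.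
  have hud : InformationTheory.UniquelyDecodable ((Finset.univ.image f : Finset (List Bool)) :
      Set (List Bool)) := by
    intro L₁
    induction L₁ with
    | nil =>
      intro L₂ _ h2 h
      cases L₂ with
      | nil => rfl
      | cons y L₂ =>
        have hy := h2 y List.mem_cons_self
        simp only [Finset.coe_image, Finset.coe_univ, Set.image_univ, Set.mem_range] at hy
        obtain ⟨i, rfl⟩ := hy
        have := hne i
        simp at h
        exact absurd h.1 this
    | cons x L₁ ih =>
      intro L₂ h1 h2 h
      have hx := h1 x List.mem_cons_self
      simp only [Finset.coe_image, Finset.coe_univ, Set.image_univ, Set.mem_range] at hx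
      obtain ⟨i, rfl⟩ := hx
      cases L₂ with
      | nil =>
        have := hne i
        simp at h
        exact absurd h.1 this
      | cons y L₂ =>
        have hy := h2 y List.mem_cons_self
        simp only [Finset.coe_image, Finset.coe_univ, Set.image_univ, Set.mem_range] at hy
        obtain ⟨j, rfl⟩ := hy
        simp only [List.flatten_cons] at h
        have hp : f i <+: f j ++ L₂.flatten := h ▸ List.prefix_append _ _
        have hij : i = j := by
          rcases le_total (f i).length (f j).length with h3 | h3
          · exact hf _ _ (List.prefix_of_prefix_length_le hp (List.prefix_append _ _) h3)
          · exact (hf _ _ (List.prefix_of_prefix_length_le (List.prefix_append _ _) hp h3)).symm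
        subst hij
        rw [ih L₂ (fun w hw => h1 w (List.mem_cons_of_mem _ hw))
          (fun w hw => h2 w (List.mem_cons_of_mem _ hw)) (List.append_cancel_left h)]
  have := InformationTheory.kraft_mcmillan_inequality hud
  rw [Finset.sum_image (fun i _ j _ h => hinj h)] at this
  simpa using this

/-- The code lengths of the grammars of the strings of a given length satisfy Kraft's inequality. -/
theorem IsGrammarTransform.sum_two_inv_pow_codeLength_le_one {α : Type*} [Fintype α]
    {Γ : List α → AdmissibleGrammar α} (hΓ : IsGrammarTransform Γ)
    (e : α ≃ Fin (Fintype.card α)) {b : ℕ → List Bool} (hb : IsNaturalNumberCode b)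
    {n : ℕ} (hn : n ≠ 0) :
    ∑ x : Fin n → α, (2⁻¹ : ℝ) ^ ((Γ (List.ofFn x)).codeLength e b) ≤ 1 := by
  have hne : ∀ x : Fin n → α, List.ofFn x ≠ [] := by
    intro x h
    have := congrArg List.length h
    simp at this
    exact hn this
  refine sum_two_inv_pow_length_le_one (fun x : Fin n → α => (Γ (List.ofFn x)).encode e b) ?_ ?_
  · intro x y h
    have h1 := AdmissibleGrammar.eq_of_encode_prefix hb h
    have hx := (AdmissibleGrammar.generatesOnly_iff _ _).1 (hΓ _ (hne x))
    have hy := (AdmissibleGrammar.generatesOnly_iff _ _).1 (hΓ _ (hne y))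
    rw [h1] at hx
    exact List.ofFn_injective (hx.symm.trans hy)
  · intro x
    rw [← List.length_pos_iff]
    change 0 < AdmissibleGrammar.codeLength e b _
    rw [AdmissibleGrammar.codeLength_eq]
    have := hb.length_pos (Fintype.card α + 1)
    omega

/-! ### Repeats, and cutting a grammar at a position of its string. -/

/-- The string `u` occurs in `w` at two distinct positions. -/
def IsRepeatedIn {α : Type*} (u w : List α) : Prop :=
  ∃ p q, p ≠ q ∧ u <+: w.drop p ∧ u <+: w.drop q

namespace AdmissibleGrammar

section Split

variable {α : Type*}

/-- The grammar with the same nonterminals as `G` and other right-hand sides. -/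
def withRhs (G : AdmissibleGrammar α) (r : Fin G.vocab → List (Symbol α (Fin G.vocab)))
    (hr : ∀ i j, Symbol.nonterminal j ∈ r i → i < j) : AdmissibleGrammar α where
  vocab := G.vocab
  vocab_pos := G.vocab_pos
  rhs := r
  acyclic := hr

open Classical in
/-- What is left of a symbol to the left of a cut after `c` letters of its expansion:
nonterminals not in `R` are retained. -/
noncomputable def cutLeft (G : AdmissibleGrammar α) (R : Fin G.vocab → Prop) (c : ℕ) :
    Symbol α (Fin G.vocab) → List (Symbol α (Fin G.vocab))
  | Symbol.terminal a => ([a].take c).map Symbol.terminal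
  | Symbol.nonterminal j =>
    if R j then ((G.expand j).take c).map Symbol.terminal else [Symbol.nonterminal j]

open Classical in
/-- What is left of a symbol to the right of a cut after `c` letters of its expansion:
nonterminals not in `R` are retained. -/
noncomputable def cutRight (G : AdmissibleGrammar α) (R : Fin G.vocab → Prop) (c : ℕ) :
    Symbol α (Fin G.vocab) → List (Symbol α (Fin G.vocab))
  | Symbol.terminal a => ([a].drop c).map Symbol.terminal
  | Symbol.nonterminal j =>
    if R j then ((G.expand j).drop c).map Symbol.terminal else [Symbol.nonterminal j]

/-- The part of a string of symbols to the left of a cut after `c` letters of its expansion. -/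
noncomputable def splitLeft (G : AdmissibleGrammar α) (R : Fin G.vocab → Prop) :
    ℕ → List (Symbol α (Fin G.vocab)) → List (Symbol α (Fin G.vocab))
  | _, [] => []
  | c, x :: l =>
    if (G.expandSymbol x).length ≤ c then x :: G.splitLeft R (c - (G.expandSymbol x).length) l
    else G.cutLeft R c x

/-- The part of a string of symbols to the right of a cut after `c` letters of its expansion. -/
noncomputable def splitRight (G : AdmissibleGrammar α) (R : Fin G.vocab → Prop) :
    ℕ → List (Symbol α (Fin G.vocab)) → List (Symbol α (Fin G.vocab))
  | _, [] => []
  | c, x :: l =>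
    if (G.expandSymbol x).length ≤ c then G.splitRight R (c - (G.expandSymbol x).length) l
    else G.cutRight R c x ++ l

theorem mem_of_mem_cutLeft {G : AdmissibleGrammar α} {R : Fin G.vocab → Prop} {c : ℕ}
    {x : Symbol α (Fin G.vocab)} {j : Fin G.vocab}
    (h : Symbol.nonterminal j ∈ G.cutLeft R c x) : Symbol.nonterminal j = x := by
  cases x with
  | terminal a => simp [cutLeft, -List.map_take, -List.map_drop] at h
  | nonterminal k =>
    simp only [cutLeft] at h
    split_ifs at h
    · simp [-List.map_take, -List.map_drop] at h
    · simpa using h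

theorem mem_of_mem_cutRight {G : AdmissibleGrammar α} {R : Fin G.vocab → Prop} {c : ℕ}
    {x : Symbol α (Fin G.vocab)} {j : Fin G.vocab}
    (h : Symbol.nonterminal j ∈ G.cutRight R c x) : Symbol.nonterminal j = x := by
  cases x with
  | terminal a => simp [cutRight, -List.map_take, -List.map_drop] at h
  | nonterminal k =>
    simp only [cutRight] at h
    split_ifs at h
    · simp [-List.map_take, -List.map_drop] at h
    · simpa using h

theorem mem_of_mem_splitLeft {G : AdmissibleGrammar α} {R : Fin G.vocab → Prop} {j : Fin G.vocab}
    {l : List (Symbol α (Fin G.vocab))} {c : ℕ}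
    (h : Symbol.nonterminal j ∈ G.splitLeft R c l) : Symbol.nonterminal j ∈ l := by
  induction l generalizing c with
  | nil => simp [splitLeft] at h
  | cons x l ih =>
    rw [splitLeft] at h
    split_ifs at h
    · rcases List.mem_cons.1 h with h | h
      · simp [h]
      · exact List.mem_cons_of_mem _ (ih h)
    · exact List.mem_cons.2 (Or.inl (mem_of_mem_cutLeft h))

theorem mem_of_mem_splitRight {G : AdmissibleGrammar α} {R : Fin G.vocab → Prop} {j : Fin G.vocab}
    {l : List (Symbol α (Fin G.vocab))} {c : ℕ}
    (h : Symbol.nonterminal j ∈ G.splitRight R c l) : Symbol.nonterminal j ∈ l := by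
  induction l generalizing c with
  | nil => simp [splitRight] at h
  | cons x l ih =>
    rw [splitRight] at h
    split_ifs at h
    · exact List.mem_cons_of_mem _ (ih h)
    · rcases List.mem_append.1 h with h | h
      · exact List.mem_cons.2 (Or.inl (mem_of_mem_cutRight h))
      · exact List.mem_cons_of_mem _ h

theorem prefix_drop_of_append_prefix_drop {u v w : List α} {p : ℕ} (h : u ++ v <+: w.drop p) :
    v <+: w.drop (p + u.length) := by
  rw [← List.drop_drop]
  obtain ⟨t, ht⟩ := h
  rw [← ht]
  simp

theorem flatMap_map_terminal {β : Type*} {N : Symbol α β → List α}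
    (hterm : ∀ a, N (Symbol.terminal a) = [a]) (l : List α) :
    (l.map Symbol.terminal).flatMap N = l := by
  simp [List.flatMap_map, hterm]

/-- If the expansions of the nonterminals outside `R` are cut at position `n` of `w`, so is the
expansion of a string of symbols cut at that position. -/
theorem flatMap_splitLeft {G : AdmissibleGrammar α} {R : Fin G.vocab → Prop} {w : List α} {n : ℕ}
    {N : Symbol α (Fin G.vocab) → List α} (hterm : ∀ a, N (Symbol.terminal a) = [a])
    {l : List (Symbol α (Fin G.vocab))} {p : ℕ}
    (hR : ∀ j, Symbol.nonterminal j ∈ l → R j → N (Symbol.nonterminal j) = G.expand j)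
    (hN : ∀ j, Symbol.nonterminal j ∈ l → ¬ R j → ∀ q, G.expand j <+: w.drop q →
      N (Symbol.nonterminal j) = (G.expand j).take (n - q))
    (hl : l.flatMap G.expandSymbol <+: w.drop p) :
    (G.splitLeft R (n - p) l).flatMap N = (l.flatMap G.expandSymbol).take (n - p) := by
  induction l generalizing p with
  | nil => simp [splitLeft]
  | cons x l ih =>
    rw [List.flatMap_cons] at hl
    have hx : G.expandSymbol x <+: w.drop p := (List.prefix_append _ _).trans hl
    rw [splitLeft, List.flatMap_cons]
    split_ifs with h
    · have h1 : N x = G.expandSymbol x := by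
        cases x with
        | terminal a => exact hterm a
        | nonterminal j =>
          by_cases hj : R j
          · exact hR j List.mem_cons_self hj
          · rw [hN j List.mem_cons_self hj p hx]
            exact List.take_of_length_le h
      rw [List.flatMap_cons, h1, Nat.sub_sub, ih (fun j hj => hR j (List.mem_cons_of_mem _ hj))
        (fun j hj => hN j (List.mem_cons_of_mem _ hj)) (prefix_drop_of_append_prefix_drop hl),
        List.take_append, List.take_of_length_le h, Nat.sub_sub]
    · have h' : n - p ≤ (G.expandSymbol x).length := by omega
      rw [List.take_append_of_le_length h']
      cases x with
      | terminal a => exact flatMap_map_terminal hterm _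
      | nonterminal j =>
        simp only [cutLeft]
        split_ifs with hj
        · exact flatMap_map_terminal hterm _
        · rw [List.flatMap_singleton, hN j List.mem_cons_self hj p hx]
          rfl

theorem flatMap_splitRight {G : AdmissibleGrammar α} {R : Fin G.vocab → Prop} {w : List α} {n : ℕ}
    {N : Symbol α (Fin G.vocab) → List α} (hterm : ∀ a, N (Symbol.terminal a) = [a])
    {l : List (Symbol α (Fin G.vocab))} {p : ℕ}
    (hR : ∀ j, Symbol.nonterminal j ∈ l → R j → N (Symbol.nonterminal j) = G.expand j)
    (hN : ∀ j, Symbol.nonterminal j ∈ l → ¬ R j → ∀ q, G.expand j <+: w.drop q →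
      N (Symbol.nonterminal j) = (G.expand j).drop (n - q))
    (hl : l.flatMap G.expandSymbol <+: w.drop p) :
    (G.splitRight R (n - p) l).flatMap N = (l.flatMap G.expandSymbol).drop (n - p) := by
  -- Symbols wholly to the right of the cut are untouched: there `n - q` truncates to 0 and nothing
  -- is dropped.
  have later : ∀ (l' : List (Symbol α (Fin G.vocab))) (q : ℕ), n ≤ q → (∀ x ∈ l', x ∈ l) →
      l'.flatMap G.expandSymbol <+: w.drop q → l'.flatMap N = l'.flatMap G.expandSymbol := by
    intro l'
    induction l' with
    | nil => simp
    | cons x l' ih' =>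
      intro q hq hmem hl'
      rw [List.flatMap_cons] at hl'
      have hx : G.expandSymbol x <+: w.drop q := (List.prefix_append _ _).trans hl'
      rw [List.flatMap_cons, List.flatMap_cons, ih' (q + (G.expandSymbol x).length) (by omega)
        (fun y hy => hmem y (List.mem_cons_of_mem _ hy)) (prefix_drop_of_append_prefix_drop hl')]
      congr 1
      cases x with
      | terminal a => exact hterm a
      | nonterminal j =>
        by_cases hj : R j
        · exact hR j (hmem _ List.mem_cons_self) hj
        · rw [hN j (hmem _ List.mem_cons_self) hj q hx, Nat.sub_eq_zero_of_le hq]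
          rfl
  induction l generalizing p with
  | nil => simp [splitRight]
  | cons x l ih =>
    rw [List.flatMap_cons] at hl
    have hx : G.expandSymbol x <+: w.drop p := (List.prefix_append _ _).trans hl
    rw [splitRight, List.flatMap_cons]
    split_ifs with h
    · rw [Nat.sub_sub, ih (fun j hj => hR j (List.mem_cons_of_mem _ hj))
        (fun j hj => hN j (List.mem_cons_of_mem _ hj)) (prefix_drop_of_append_prefix_drop hl)
        (fun l' q hq hm => later l' q hq fun y hy => List.mem_cons_of_mem _ (hm y hy)),
        List.drop_append, List.drop_of_length_le h, Nat.sub_sub, List.nil_append]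
    · have h' : n - p ≤ (G.expandSymbol x).length := by omega
      rw [List.drop_append_of_le_length h', List.flatMap_append,
        later l (p + (G.expandSymbol x).length) (by omega)
          (fun y hy => List.mem_cons_of_mem _ hy) (prefix_drop_of_append_prefix_drop hl)]
      congr 1
      cases x with
      | terminal a => exact flatMap_map_terminal hterm _
      | nonterminal j =>
        simp only [cutRight]
        split_ifs with hj
        · exact flatMap_map_terminal hterm _
        · rw [List.flatMap_singleton, hN j List.mem_cons_self hj p hx]
          rfl

/-- A nonterminal whose expansion occurs more than once in the string generated by the grammar. -/
def IsRepeated (G : AdmissibleGrammar α) (i : Fin G.vocab) : Prop :=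
  IsRepeatedIn (G.expand i) (G.expand ⟨0, G.vocab_pos⟩)

theorem exists_expand_infix {G : AdmissibleGrammar α} {i j : Fin G.vocab}
    (h : Symbol.nonterminal j ∈ G.rhs i) : ∃ u v, G.expand i = u ++ (G.expand j ++ v) := by
  obtain ⟨l, l', hl⟩ := List.append_of_mem h
  refine ⟨l.flatMap G.expandSymbol, l'.flatMap G.expandSymbol, ?_⟩
  rw [G.expand_eq i, hl, List.flatMap_append, List.flatMap_cons]
  rfl

/-- The inner expansion sits at a fixed offset in the outer one, so distinct occurrences remain
distinct. -/
theorem IsRepeated.of_mem_rhs {G : AdmissibleGrammar α} {i j : Fin G.vocab} (hi : G.IsRepeated i)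
    (h : Symbol.nonterminal j ∈ G.rhs i) : G.IsRepeated j := by
  obtain ⟨u, v, huv⟩ := exists_expand_infix h
  obtain ⟨p, q, hpq, hp, hq⟩ := hi
  rw [huv] at hp hq
  exact ⟨p + u.length, q + u.length, by omega,
    (List.prefix_append _ _).trans (prefix_drop_of_append_prefix_drop hp),
    (List.prefix_append _ _).trans (prefix_drop_of_append_prefix_drop hq)⟩

open Classical in
/-- A position at which the expansion of a nonterminal occurs. -/
noncomputable def position (G : AdmissibleGrammar α) (i : Fin G.vocab) : ℕ :=
  -- The default 0 is harmless: a nonterminal whose expansion does not occur contributes nothing to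
  -- the string.
  if h : ∃ p, G.expand i <+: (G.expand ⟨0, G.vocab_pos⟩).drop p then h.choose else 0

theorem position_eq {G : AdmissibleGrammar α} {i : Fin G.vocab} (hi : ¬ G.IsRepeated i) {q : ℕ}
    (hq : G.expand i <+: (G.expand ⟨0, G.vocab_pos⟩).drop q) : G.position i = q := by
  have h : ∃ p, G.expand i <+: (G.expand ⟨0, G.vocab_pos⟩).drop p := ⟨q, hq⟩
  rw [position, dif_pos h]
  by_contra hne
  exact hi ⟨_, q, hne, h.choose_spec, hq⟩

open Classical in
/-- A grammar for the first `n` letters of the string generated by `G`. -/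
noncomputable def leftPart (G : AdmissibleGrammar α) (n : ℕ) : AdmissibleGrammar α :=
  G.withRhs (fun i => if G.IsRepeated i then G.rhs i
    else G.splitLeft G.IsRepeated (n - G.position i) (G.rhs i)) <| by
    intro i j h
    split_ifs at h
    · exact G.acyclic i j h
    · exact G.acyclic i j (mem_of_mem_splitLeft h)

open Classical in
/-- A grammar for what follows the first `n` letters of the string generated by `G`. -/
noncomputable def rightPart (G : AdmissibleGrammar α) (n : ℕ) : AdmissibleGrammar α :=
  G.withRhs (fun i => if G.IsRepeated i then G.rhs i
    else G.splitRight G.IsRepeated (n - G.position i) (G.rhs i)) <| by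
    intro i j h
    split_ifs at h
    · exact G.acyclic i j h
    · exact G.acyclic i j (mem_of_mem_splitRight h)

theorem flatMap_congr' {β γ : Type*} {l : List β} {f g : β → List γ} (h : ∀ x ∈ l, f x = g x) :
    l.flatMap f = l.flatMap g := by
  induction l with
  | nil => rfl
  | cons x l ih =>
    rw [List.flatMap_cons, List.flatMap_cons, h x List.mem_cons_self,
      ih fun y hy => h y (List.mem_cons_of_mem _ hy)]

/-- A repeated nonterminal calls only repeated ones, so its rule survives whole. A nonrepeated one
has a single position, so cutting the string at letter `n` means cutting its rule at one definite
place, and the cut descends through the rules by recursion. The second claim is vacuous for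
expansions that do not occur. -/
theorem expand_leftPart (G : AdmissibleGrammar α) (n : ℕ) (i : Fin G.vocab) :
    (G.IsRepeated i → (G.leftPart n).expand i = G.expand i) ∧
    (¬ G.IsRepeated i → ∀ q, G.expand i <+: (G.expand ⟨0, G.vocab_pos⟩).drop q →
      (G.leftPart n).expand i = (G.expand i).take (n - q)) := by
  have ih : ∀ j, Symbol.nonterminal j ∈ G.rhs i →
      (G.IsRepeated j → (G.leftPart n).expand j = G.expand j) ∧
      (¬ G.IsRepeated j → ∀ q, G.expand j <+: (G.expand ⟨0, G.vocab_pos⟩).drop q →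
      (G.leftPart n).expand j = (G.expand j).take (n - q)) := fun j hj => expand_leftPart G n j
  have hrhs := (G.leftPart n).expand_eq i
  constructor
  · intro hi
    have h1 : (G.leftPart n).rhs i = G.rhs i := if_pos hi
    rw [hrhs, G.expand_eq i, h1]
    apply flatMap_congr'
    intro x hx
    cases x with
    | terminal a => rfl
    | nonterminal j => exact (ih j hx).1 (hi.of_mem_rhs hx)
  · intro hi q hq
    have h1 : (G.leftPart n).rhs i = G.splitLeft G.IsRepeated (n - q) (G.rhs i) := by
      rw [← position_eq hi hq]
      exact if_neg hi
    rw [hrhs, h1, G.expand_eq i]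
    exact flatMap_splitLeft (fun _ => rfl) (fun j hj => (ih j hj).1) (fun j hj => (ih j hj).2)
      (by rwa [← G.expand_eq i])
termination_by G.vocab - i.val
decreasing_by
  have h : i.val < j.val := G.acyclic i j hj
  have := j.isLt
  omega

theorem expand_rightPart (G : AdmissibleGrammar α) (n : ℕ) (i : Fin G.vocab) :
    (G.IsRepeated i → (G.rightPart n).expand i = G.expand i) ∧
    (¬ G.IsRepeated i → ∀ q, G.expand i <+: (G.expand ⟨0, G.vocab_pos⟩).drop q →
      (G.rightPart n).expand i = (G.expand i).drop (n - q)) := by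
  have ih : ∀ j, Symbol.nonterminal j ∈ G.rhs i →
      (G.IsRepeated j → (G.rightPart n).expand j = G.expand j) ∧
      (¬ G.IsRepeated j → ∀ q, G.expand j <+: (G.expand ⟨0, G.vocab_pos⟩).drop q →
      (G.rightPart n).expand j = (G.expand j).drop (n - q)) := fun j hj => expand_rightPart G n j
  have hrhs := (G.rightPart n).expand_eq i
  constructor
  · intro hi
    have h1 : (G.rightPart n).rhs i = G.rhs i := if_pos hi
    rw [hrhs, G.expand_eq i, h1]
    apply flatMap_congr'
    intro x hx
    cases x with
    | terminal a => rfl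
    | nonterminal j => exact (ih j hx).1 (hi.of_mem_rhs hx)
  · intro hi q hq
    have h1 : (G.rightPart n).rhs i = G.splitRight G.IsRepeated (n - q) (G.rhs i) := by
      rw [← position_eq hi hq]
      exact if_neg hi
    rw [hrhs, h1, G.expand_eq i]
    exact flatMap_splitRight (fun _ => rfl) (fun j hj => (ih j hj).1) (fun j hj => (ih j hj).2)
      (by rwa [← G.expand_eq i])
termination_by G.vocab - i.val
decreasing_by
  have h : i.val < j.val := G.acyclic i j hj
  have := j.isLt
  omega

/-- A nonempty string fits into itself only at offset 0. The empty string would be a prefix at every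
offset and would count as repeated. -/
theorem not_isRepeated_start {G : AdmissibleGrammar α} {w : List α} (hw : w ≠ [])
    (hG : G.GeneratesOnly w) : ¬ G.IsRepeated ⟨0, G.vocab_pos⟩ := by
  rw [generatesOnly_iff] at hG
  rw [IsRepeated, hG]
  have hpos := List.length_pos_iff.2 hw
  have key : ∀ p, w <+: w.drop p → p = 0 := by
    intro p hp
    have := hp.length_le
    rw [List.length_drop] at this
    omega
  rintro ⟨p, q, hpq, hp, hq⟩
  exact hpq ((key p hp).trans (key q hq).symm)

theorem leftPart_generatesOnly {G : AdmissibleGrammar α} {u v : List α} (huv : u ++ v ≠ [])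
    (hG : G.GeneratesOnly (u ++ v)) : (G.leftPart u.length).GeneratesOnly u := by
  have h := (G.expand_leftPart u.length ⟨0, G.vocab_pos⟩).2 (not_isRepeated_start huv hG) 0
    (by rw [List.drop_zero])
  rw [generatesOnly_iff] at hG ⊢
  rw [hG] at h
  exact h.trans (by simp)

theorem rightPart_generatesOnly {G : AdmissibleGrammar α} {u v : List α} (huv : u ++ v ≠ [])
    (hG : G.GeneratesOnly (u ++ v)) : (G.rightPart u.length).GeneratesOnly v := by
  have h := (G.expand_rightPart u.length ⟨0, G.vocab_pos⟩).2 (not_isRepeated_start huv hG) 0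
    (by rw [List.drop_zero])
  rw [generatesOnly_iff] at hG ⊢
  rw [hG] at h
  exact h.trans (by simp)

end Split

end AdmissibleGrammar

/-! ### Code lengths of cut grammars, expanded rules and dictionary grammars. -/

namespace AdmissibleGrammar

variable {α : Type*} [Fintype α] {e : α ≃ Fin (Fintype.card α)} {b : ℕ → List Bool}

theorem codeLength_withRhs (G : AdmissibleGrammar α)
    (r : Fin G.vocab → List (Symbol α (Fin G.vocab)))
    (hr : ∀ i j, Symbol.nonterminal j ∈ r i → i < j) :
    (G.withRhs r hr).codeLength e b = ∑ i, symbolsLength e b i (r i)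
      + (G.vocab - 1) * (b (Fintype.card α)).length + (b (Fintype.card α + 1)).length :=
  codeLength_eq e b (G.withRhs r hr)

@[simp]
theorem symbolsLength_nil {m : ℕ} (i : Fin m) :
    symbolsLength e b i ([] : List (Symbol α (Fin m))) = 0 := rfl

theorem symbolsLength_cons {m : ℕ} (i : Fin m) (x : Symbol α (Fin m))
    (l : List (Symbol α (Fin m))) :
    symbolsLength e b i (x :: l) = (b (symbolNumber e i x)).length + symbolsLength e b i l := rfl

theorem symbolsLength_append {m : ℕ} (i : Fin m) (l l' : List (Symbol α (Fin m))) :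
    symbolsLength e b i (l ++ l') = symbolsLength e b i l + symbolsLength e b i l' := by
  simp [symbolsLength]

theorem symbolsLength_terminal_le (hb : IsNaturalNumberCode b) {m : ℕ} (i : Fin m) (l : List α) :
    symbolsLength e b i (l.map Symbol.terminal) ≤
      l.length * (b (Fintype.card α + 1)).length := by
  induction l with
  | nil => simp
  | cons a l ih =>
    rw [List.map_cons, symbolsLength_cons, List.length_cons, Nat.add_mul, one_mul, add_comm]
    have h : (b (symbolNumber e i (Symbol.terminal a))).length ≤
        (b (Fintype.card α + 1)).length := by
      apply hb.monotone_length
      have := (e a).isLt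
      simp only [symbolNumber]
      omega
    omega

theorem length_symbolNumber_le (hb : IsNaturalNumberCode b) {m : ℕ} (i : Fin m)
    (x : Symbol α (Fin m)) :
    (b (symbolNumber e i x)).length ≤ (b (Fintype.card α + 1 + m)).length := by
  apply hb.monotone_length
  cases x with
  | terminal a =>
    have := (e a).isLt
    simp only [symbolNumber]
    omega
  | nonterminal j =>
    have := j.isLt
    simp only [symbolNumber]
    omega

/-- A terminal falls on one side. A repeated nonterminal is spelled out, at most `L` letters in
total over both sides. Any other nonterminal is referred to on both sides, which costs one extra
reference. The bound allows for all cases at once. -/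
theorem symbolsLength_cut_le (hb : IsNaturalNumberCode b) {G : AdmissibleGrammar α}
    {R : Fin G.vocab → Prop} {L : ℕ} (hL : ∀ j, R j → (G.expand j).length ≤ L) (i : Fin G.vocab)
    (c : ℕ) (x : Symbol α (Fin G.vocab)) :
    symbolsLength e b i (G.cutLeft R c x) + symbolsLength e b i (G.cutRight R c x) ≤
      (b (symbolNumber e i x)).length + ((b (Fintype.card α + 1 + G.vocab)).length
        + L * (b (Fintype.card α + 1)).length) := by
  cases x with
  | terminal a =>
    rw [cutLeft, cutRight, ← symbolsLength_append, ← List.map_append, List.take_append_drop]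
    simp only [List.map_cons, List.map_nil, symbolsLength_cons, symbolsLength_nil]
    omega
  | nonterminal j =>
    rw [cutLeft, cutRight]
    split_ifs with hj
    · rw [← symbolsLength_append, ← List.map_append, List.take_append_drop]
      have h1 := symbolsLength_terminal_le (e := e) hb i (G.expand j)
      have h2 := Nat.mul_le_mul_right (b (Fintype.card α + 1)).length (hL j hj)
      omega
    · have h1 := length_symbolNumber_le (e := e) hb i (Symbol.nonterminal j)
      simp only [symbolsLength_cons, symbolsLength_nil]
      omega

/-- At most one symbol of a rule straddles the cut; every other one passes unchanged to exactly one
side. -/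
theorem symbolsLength_split_le (hb : IsNaturalNumberCode b) {G : AdmissibleGrammar α}
    {R : Fin G.vocab → Prop} {L : ℕ} (hL : ∀ j, R j → (G.expand j).length ≤ L) (i : Fin G.vocab)
    (c : ℕ) (l : List (Symbol α (Fin G.vocab))) :
    symbolsLength e b i (G.splitLeft R c l) + symbolsLength e b i (G.splitRight R c l) ≤
      symbolsLength e b i l + ((b (Fintype.card α + 1 + G.vocab)).length
        + L * (b (Fintype.card α + 1)).length) := by
  induction l generalizing c with
  | nil => simp [splitLeft, splitRight]
  | cons x l ih =>
    rw [splitLeft, splitRight]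
    split_ifs with h
    · have := ih (c - (G.expandSymbol x).length)
      rw [symbolsLength_cons, symbolsLength_cons]
      omega
    · have := symbolsLength_cut_le (e := e) hb hL i c x
      rw [symbolsLength_append, symbolsLength_cons]
      omega

/-- Splitting a grammar costs little if the repeated nonterminals have short expansions and
right-hand sides. -/
theorem codeLength_parts_le (hb : IsNaturalNumberCode b) {G : AdmissibleGrammar α} {L : ℕ}
    (hL : ∀ j, G.IsRepeated j → (G.expand j).length ≤ L)
    (hrhs : ∀ i, symbolsLength e b i (G.rhs i) ≤
      (G.expand i).length * (b (Fintype.card α + 1)).length) (n : ℕ) :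
    (G.leftPart n).codeLength e b + (G.rightPart n).codeLength e b ≤ G.codeLength e b
      + G.vocab * ((b (Fintype.card α + 1 + G.vocab)).length
        + (L + 1) * (b (Fintype.card α + 1)).length) := by
  have hl : (G.leftPart n).codeLength e b = _ := codeLength_eq e b (G.leftPart n)
  have hr : (G.rightPart n).codeLength e b = _ := codeLength_eq e b (G.rightPart n)
  have key : ∀ i : Fin G.vocab, symbolsLength e b i ((G.leftPart n).rhs i)
      + symbolsLength e b i ((G.rightPart n).rhs i) ≤ symbolsLength e b i (G.rhs i)
        + ((b (Fintype.card α + 1 + G.vocab)).length + L * (b (Fintype.card α + 1)).length) := by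
    intro i
    by_cases hi : G.IsRepeated i
    · have h1 : (G.leftPart n).rhs i = G.rhs i := if_pos hi
      have h2 : (G.rightPart n).rhs i = G.rhs i := if_pos hi
      rw [h1, h2]
      -- The rule of a repeated nonterminal stands in both halves; its second copy costs at most its
      -- expansion, hence at most `L` letters.
      have h3 := Nat.mul_le_mul_right (b (Fintype.card α + 1)).length (hL i hi)
      have h4 := hrhs i
      omega
    · have h1 : (G.leftPart n).rhs i = _ := if_neg hi
      have h2 : (G.rightPart n).rhs i = _ := if_neg hi
      rw [h1, h2]
      exact symbolsLength_split_le hb hL i _ _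
  have hsum := Finset.sum_le_sum fun i (_ : i ∈ (Finset.univ : Finset (Fin G.vocab))) => key i
  rw [Finset.sum_add_distrib, Finset.sum_add_distrib, Finset.sum_const, Finset.card_univ,
    Fintype.card_fin, smul_eq_mul] at hsum
  have hD : (b (Fintype.card α)).length ≤ (b (Fintype.card α + 1)).length :=
    hb.monotone_length (Nat.le_succ _)
  rw [hl, hr, codeLength_eq]
  change _ + (G.vocab - 1) * _ + _ + (_ + (G.vocab - 1) * _ + _) ≤ _
  -- The `+ 1` in `L + 1` pays for the second set of separators and the second end mark.
  have h5 := Nat.mul_le_mul_left (G.vocab - 1) hD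
  have h6 : G.vocab * (b (Fintype.card α + 1)).length =
      (G.vocab - 1) * (b (Fintype.card α + 1)).length + (b (Fintype.card α + 1)).length := by
    obtain ⟨m, hm⟩ : ∃ m, G.vocab = m + 1 := ⟨G.vocab - 1, by have := G.vocab_pos; omega⟩
    rw [hm, Nat.add_sub_cancel, Nat.add_mul, one_mul]
  have h7 : G.vocab * ((b (Fintype.card α + 1 + G.vocab)).length
        + (L + 1) * (b (Fintype.card α + 1)).length) =
      G.vocab * ((b (Fintype.card α + 1 + G.vocab)).length
        + L * (b (Fintype.card α + 1)).length) + G.vocab * (b (Fintype.card α + 1)).length := by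
    ring
  change (∑ i : Fin G.vocab, symbolsLength e b i ((G.leftPart n).rhs i)) + _ + _ +
    ((∑ i : Fin G.vocab, symbolsLength e b i ((G.rightPart n).rhs i)) + _ + _) ≤ _
  rw [h7]
  omega

/-- The grammar obtained by rewriting the `i`-th rule completely. -/
def expandRule (G : AdmissibleGrammar α) (i : Fin G.vocab) : AdmissibleGrammar α :=
  G.withRhs (Function.update G.rhs i ((G.expand i).map Symbol.terminal)) <| by
    intro k j h
    by_cases hk : k = i
    · subst hk
      simp at h
    · rw [Function.update_of_ne hk] at h
      exact G.acyclic k j h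

theorem expand_expandRule {α : Type*} (G : AdmissibleGrammar α) (i k : Fin G.vocab) :
    (G.expandRule i).expand k = G.expand k := by
  have ih : ∀ j, Symbol.nonterminal j ∈ G.rhs k → (G.expandRule i).expand j = G.expand j :=
    fun j hj => expand_expandRule G i j
  have hrhs := (G.expandRule i).expand_eq k
  by_cases hk : k = i
  · subst hk
    have h1 : (G.expandRule k).rhs k = (G.expand k).map Symbol.terminal :=
      Function.update_self _ _ _
    rw [hrhs, h1]
    exact flatMap_map_terminal (fun _ => rfl) _
  · have h1 : (G.expandRule i).rhs k = G.rhs k := Function.update_of_ne hk _ _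
    rw [hrhs, h1, G.expand_eq k]
    apply flatMap_congr'
    intro x hx
    cases x with
    | terminal a => rfl
    | nonterminal j => exact ih j hx
termination_by G.vocab - k.val
decreasing_by
  have h : k.val < j.val := G.acyclic k j hj
  have := j.isLt
  omega

/-- In a grammar with the shortest encoding, no rule is longer than its complete rewriting. -/
theorem symbolsLength_rhs_le_of_minimal (hb : IsNaturalNumberCode b) {G : AdmissibleGrammar α}
    {w : List α} (hG : G.GeneratesOnly w)
    (hmin : ∀ G' : AdmissibleGrammar α, G'.GeneratesOnly w → G.codeLength e b ≤ G'.codeLength e b)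
    (i : Fin G.vocab) :
    symbolsLength e b i (G.rhs i) ≤ (G.expand i).length * (b (Fintype.card α + 1)).length := by
  have h1 : (G.expandRule i).GeneratesOnly w := by
    rw [generatesOnly_iff] at hG ⊢
    exact (G.expand_expandRule i _).trans hG
  have h2 := hmin _ h1
  rw [expandRule, codeLength_withRhs, codeLength_eq,
    ← Finset.add_sum_erase _ _ (Finset.mem_univ i),
    ← Finset.add_sum_erase Finset.univ (fun k => symbolsLength e b k
      (Function.update G.rhs i ((G.expand i).map Symbol.terminal) k))
      (Finset.mem_univ i), Function.update_self] at h2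
  have h5 : ∑ k ∈ Finset.univ.erase i, symbolsLength e b k
      (Function.update G.rhs i ((G.expand i).map Symbol.terminal) k) =
      ∑ k ∈ Finset.univ.erase i, symbolsLength e b k (G.rhs k) := by
    apply Finset.sum_congr rfl
    intro k hk
    rw [Function.update_of_ne (Finset.ne_of_mem_erase hk)]
  have h7 := symbolsLength_terminal_le (e := e) hb i (G.expand i)
  omega

/-- The grammar with a single rule. -/
def single (w : List α) : AdmissibleGrammar α where
  vocab := 1
  vocab_pos := one_pos
  rhs := fun _ => w.map Symbol.terminal
  acyclic := by simp

theorem single_generatesOnly {α : Type*} (w : List α) : (single w).GeneratesOnly w := by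
  rw [generatesOnly_iff, expand_eq]
  exact flatMap_map_terminal (fun _ => rfl) w

theorem codeLength_single_le (hb : IsNaturalNumberCode b) (w : List α) :
    (single w).codeLength e b ≤ (w.length + 1) * (b (Fintype.card α + 1)).length := by
  rw [codeLength_eq]
  change (∑ i : Fin 1, symbolsLength e b i (w.map Symbol.terminal)) + (1 - 1) * _ + _ ≤ _
  have := symbolsLength_terminal_le (e := e) hb (0 : Fin 1) w
  rw [Fin.sum_univ_one, Nat.add_mul]
  omega

theorem vocab_le_codeLength (hb : IsNaturalNumberCode b) (G : AdmissibleGrammar α) :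
    G.vocab ≤ G.codeLength e b := by
  rw [codeLength_eq]
  have h1 := hb.length_pos (Fintype.card α)
  have h2 := hb.length_pos (Fintype.card α + 1)
  have h3 := Nat.mul_le_mul_left (G.vocab - 1) h1
  omega

/-- The grammar whose start rule is a sequence of nonterminals that stand for the entries of a
dictionary. -/
def ofDictionary {T : Type*} [Fintype T] (d : T → List α) (idx : T ≃ Fin (Fintype.card T))
    (ts : List T) : AdmissibleGrammar α where
  vocab := Fintype.card T + 1
  vocab_pos := Nat.succ_pos _
  rhs := Fin.cases (ts.map fun t => Symbol.nonterminal (idx t).succ)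
    fun j => (d (idx.symm j)).map Symbol.terminal
  acyclic := by
    intro i j
    refine Fin.cases ?_ (fun k => ?_) i
    · intro h
      obtain ⟨t, _, ht⟩ := List.mem_map.1 h
      cases ht
      exact Fin.succ_pos _
    · intro h
      simp at h

theorem ofDictionary_generatesOnly {α : Type*} {T : Type*} [Fintype T] (d : T → List α)
    (idx : T ≃ Fin (Fintype.card T)) (ts : List T) :
    (ofDictionary d idx ts).GeneratesOnly (ts.flatMap d) := by
  have h : ∀ j : Fin (Fintype.card T), (ofDictionary d idx ts).expand j.succ = d (idx.symm j) := by
    intro j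
    refine ((ofDictionary d idx ts).expand_eq j.succ).trans ?_
    exact flatMap_map_terminal (fun _ => rfl) (d (idx.symm j))
  rw [generatesOnly_iff, expand_eq]
  refine (List.flatMap_map (fun t => Symbol.nonterminal (idx t).succ) _ ts).trans ?_
  apply flatMap_congr'
  intro t _
  exact (h (idx t)).trans (by rw [Equiv.symm_apply_apply])

theorem codeLength_ofDictionary_le (hb : IsNaturalNumberCode b) {T : Type*} [Fintype T]
    (d : T → List α) (idx : T ≃ Fin (Fintype.card T)) (ts : List T) :
    (ofDictionary d idx ts).codeLength e b ≤
      (ts.map fun t => (b (Fintype.card α + 1 + ((idx t).val + 1))).length).sum +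
        ((∑ t, (d t).length) + Fintype.card T + 1) * (b (Fintype.card α + 1)).length := by
  rw [codeLength_eq]
  change (∑ i : Fin (Fintype.card T + 1), symbolsLength e b i (Fin.cases (motive := fun _ =>
    List (Symbol α (Fin (Fintype.card T + 1)))) (ts.map fun t => Symbol.nonterminal (idx t).succ)
    (fun j => (d (idx.symm j)).map Symbol.terminal) i)) + (Fintype.card T + 1 - 1) * _ + _ ≤ _
  rw [Fin.sum_univ_succ]
  simp only [Fin.cases_zero, Fin.cases_succ]
  have h0 : symbolsLength e b (0 : Fin (Fintype.card T + 1))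
      (ts.map fun t => Symbol.nonterminal (idx t).succ) =
      (ts.map fun t => (b (Fintype.card α + 1 + ((idx t).val + 1))).length).sum := by
    rw [symbolsLength, List.map_map]
    rfl
  have h1 : ∑ j : Fin (Fintype.card T),
      symbolsLength e b j.succ ((d (idx.symm j)).map Symbol.terminal) ≤
        (∑ t, (d t).length) * (b (Fintype.card α + 1)).length := by
    rw [Finset.sum_mul, ← Equiv.sum_comp idx.symm]
    exact Finset.sum_le_sum fun j _ => symbolsLength_terminal_le hb j.succ (d (idx.symm j))
  have hD : (b (Fintype.card α)).length ≤ (b (Fintype.card α + 1)).length :=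
    hb.monotone_length (Nat.le_succ _)
  have h2 := Nat.mul_le_mul_left (Fintype.card T) hD
  rw [Nat.add_sub_cancel]
  rw [h0, Nat.add_mul, Nat.add_mul]
  omega

end AdmissibleGrammar

/-! ### Bounds for minimal grammar transforms. -/

/-- `Γ` assigns to each nonempty string a grammar with the shortest encoding with respect to the
given numbering of the alphabet and code for natural numbers. -/
structure IsMinimalFor {α : Type*} [Fintype α] (Γ : List α → AdmissibleGrammar α)
    (e : α ≃ Fin (Fintype.card α)) (b : ℕ → List Bool) : Prop where
  code : IsNaturalNumberCode b
  transform : IsGrammarTransform Γ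
  minimal : ∀ w, w ≠ [] → ∀ G : AdmissibleGrammar α, G.GeneratesOnly w →
    (Γ w).codeLength e b ≤ G.codeLength e b

namespace IsMinimalFor

variable {α : Type*} [Fintype α] {Γ : List α → AdmissibleGrammar α}
  {e : α ≃ Fin (Fintype.card α)} {b : ℕ → List Bool}

theorem codeLength_le (h : IsMinimalFor Γ e b) {w : List α} (hw : w ≠ []) :
    (Γ w).codeLength e b ≤ (w.length + 1) * (b (Fintype.card α + 1)).length :=
  (h.minimal w hw _ (AdmissibleGrammar.single_generatesOnly w)).trans
    (AdmissibleGrammar.codeLength_single_le h.code w)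

theorem vocab_le (h : IsMinimalFor Γ e b) {w : List α} (hw : w ≠ []) :
    (Γ w).vocab ≤ (w.length + 1) * (b (Fintype.card α + 1)).length :=
  (AdmissibleGrammar.vocab_le_codeLength h.code _).trans (h.codeLength_le hw)

/-- The code length of a minimal grammar transform is nearly superadditive for strings with small
vocabulary and no long repeats. -/
theorem codeLength_add_le (h : IsMinimalFor Γ e b) {u v : List α} (hu : u ≠ []) (hv : v ≠ [])
    {L : ℕ} (hL : ∀ s, IsRepeatedIn s (u ++ v) → s.length ≤ L) :
    (Γ u).codeLength e b + (Γ v).codeLength e b ≤ (Γ (u ++ v)).codeLength e b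
      + (Γ (u ++ v)).vocab * ((b (Fintype.card α + 1 + (Γ (u ++ v)).vocab)).length
        + (L + 1) * (b (Fintype.card α + 1)).length) := by
  have huv : u ++ v ≠ [] := by simp [hu]
  have hG := h.transform _ huv
  have hw := (AdmissibleGrammar.generatesOnly_iff _ _).1 hG
  have h1 := h.minimal u hu _ (AdmissibleGrammar.leftPart_generatesOnly huv hG)
  have h2 := h.minimal v hv _ (AdmissibleGrammar.rightPart_generatesOnly huv hG)
  refine (add_le_add h1 h2).trans (AdmissibleGrammar.codeLength_parts_le h.code ?_ ?_ _)
  · intro j hj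
    refine hL _ ?_
    rw [AdmissibleGrammar.IsRepeated, hw] at hj
    exact hj
  · exact AdmissibleGrammar.symbolsLength_rhs_le_of_minimal h.code hG (h.minimal _ huv)

theorem codeLength_le_ofDictionary (h : IsMinimalFor Γ e b) {T : Type*} [Fintype T]
    (d : T → List α) (idx : T ≃ Fin (Fintype.card T)) (ts : List T) (hts : ts.flatMap d ≠ []) :
    (Γ (ts.flatMap d)).codeLength e b ≤
      (ts.map fun t => (b (Fintype.card α + 1 + ((idx t).val + 1))).length).sum +
        ((∑ t, (d t).length) + Fintype.card T + 1) * (b (Fintype.card α + 1)).length :=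
  (h.minimal _ hts _ (AdmissibleGrammar.ofDictionary_generatesOnly d idx ts)).trans
    (AdmissibleGrammar.codeLength_ofDictionary_le h.code d idx ts)

end IsMinimalFor

/-! ### Finite-valued random variables and Gibbs' inequality. -/

section FiniteValued

variable {Ω T : Type*} [MeasurableSpace Ω] {P : Measure Ω} [IsProbabilityMeasure P]
  [MeasurableSpace T] [MeasurableSingletonClass T] {Y : Ω → T}

theorem integrable_comp_of_finite [Finite T] (hY : Measurable Y) (g : T → ℝ) :
    Integrable (fun ω => g (Y ω)) P := by
  have := Measure.isProbabilityMeasure_map (μ := P) hY.aemeasurable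
  exact (Integrable.of_finite (f := g) (μ := P.map Y)).comp_measurable hY

theorem integral_comp_eq_sum [Fintype T] (hY : Measurable Y) (g : T → ℝ) :
    ∫ ω, g (Y ω) ∂P = ∑ y, P.real (Y ⁻¹' {y}) * g y := by
  have := Measure.isProbabilityMeasure_map (μ := P) hY.aemeasurable
  have hg : Integrable g (P.map Y) := Integrable.of_finite
  rw [← integral_map hY.aemeasurable hg.aestronglyMeasurable, integral_fintype hg]
  refine Finset.sum_congr rfl fun y _ => ?_
  rw [map_measureReal_apply hY (measurableSet_singleton y), smul_eq_mul]

theorem sum_measureReal_preimage_singleton_eq_one [Fintype T] (hY : Measurable Y) :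
    ∑ y, P.real (Y ⁻¹' {y}) = 1 := by
  have := integral_comp_eq_sum (P := P) hY fun _ => 1
  simpa using this.symm

/-- **Gibbs' inequality**. -/
theorem integral_log_le_integral_log_prob [Fintype T] (hY : Measurable Y) {r : T → ℝ}
    (hr : ∀ y, 0 < r y) (hsum : ∑ y, r y ≤ 1) :
    ∫ ω, Real.log (r (Y ω)) ∂P ≤ ∫ ω, Real.log (P.real (Y ⁻¹' {Y ω})) ∂P := by
  rw [integral_comp_eq_sum hY fun y => Real.log (r y),
    integral_comp_eq_sum hY fun y => Real.log (P.real (Y ⁻¹' {y})), ← sub_nonpos,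
    ← Finset.sum_sub_distrib]
  have h1 : ∀ y, P.real (Y ⁻¹' {y}) * Real.log (r y) -
      P.real (Y ⁻¹' {y}) * Real.log (P.real (Y ⁻¹' {y})) ≤ r y - P.real (Y ⁻¹' {y}) := by
    intro y
    rcases (measureReal_nonneg (μ := P) (s := Y ⁻¹' {y})).eq_or_lt with h | h
    · rw [← h]
      simpa using (hr y).le
    · have h2 := Real.log_le_sub_one_of_pos (div_pos (hr y) h)
      rw [Real.log_div (hr y).ne' h.ne'] at h2
      calc _ = P.real (Y ⁻¹' {y}) * (Real.log (r y) - Real.log (P.real (Y ⁻¹' {y}))) := by ring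
        _ ≤ P.real (Y ⁻¹' {y}) * (r y / P.real (Y ⁻¹' {y}) - 1) := by gcongr
        _ = _ := by field_simp
  refine (Finset.sum_le_sum fun y _ => h1 y).trans ?_
  rw [Finset.sum_sub_distrib, sum_measureReal_preimage_singleton_eq_one hY]
  linarith

theorem ae_measureReal_preimage_singleton_pos {T : Type*} [Countable T] (Y : Ω → T) :
    ∀ᵐ ω ∂P, 0 < P.real (Y ⁻¹' {Y ω}) := by
  have h : ∀ y : T, ∀ᵐ ω ∂P, Y ω = y → 0 < P.real (Y ⁻¹' {y}) := by
    intro y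
    by_cases hy : P (Y ⁻¹' {y}) = 0
    · have h1 : ∀ᵐ ω ∂P, ω ∉ Y ⁻¹' {y} := measure_eq_zero_iff_ae_notMem.1 hy
      filter_upwards [h1] with ω hω h2
      exact absurd h2 hω
    · exact Eventually.of_forall fun ω _ =>
        ENNReal.toReal_pos hy (measure_ne_top _ _)
  filter_upwards [ae_all_iff.2 h] with ω hω
  exact hω _ rfl

end FiniteValued

/-! ### Windows of the process, stationarity and the facts. -/

section Windows

variable {Ω α : Type*}

/-- The tuple `(X_{t+1}, …, X_{t+n})`. -/
def window (X : ℤ → Ω → α) (t : ℤ) (n : ℕ) (ω : Ω) (i : Fin n) : α := X (t + 1 + (i.val : ℤ)) ω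

theorem block_eq_ofFn (X : ℤ → Ω → α) (t : ℤ) (n : ℕ) (ω : Ω) :
    block X t n ω = List.ofFn (window X t n ω) := rfl

@[simp]
theorem length_block (X : ℤ → Ω → α) (t : ℤ) (n : ℕ) (ω : Ω) : (block X t n ω).length = n := by
  simp [block]

theorem block_ne_nil (X : ℤ → Ω → α) (t : ℤ) {n : ℕ} (hn : n ≠ 0) (ω : Ω) :
    block X t n ω ≠ [] := by
  intro h
  have := congrArg List.length h
  simp at this
  exact hn this

theorem block_add (X : ℤ → Ω → α) (t : ℤ) (m n : ℕ) (ω : Ω) :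
    block X t (m + n) ω = block X t m ω ++ block X (t + m) n ω := by
  apply List.ext_getElem
  · simp
  · intro i h1 h2
    rw [List.getElem_append]
    simp only [length_block]
    split_ifs with h
    · simp [block]
    · simp only [block, List.getElem_ofFn]
      congr 1
      push_cast [Nat.le_of_not_lt h]
      omega

theorem window_shift (X : ℤ → Ω → α) (t n : ℕ) (ω : Ω) :
    window (fun (i : ℤ) (f : ℤ → α) => f i) 0 n (fun i => X (i + t) ω) = window X t n ω := by
  funext i
  simp only [window]
  congr 1
  ring

theorem window_coordinate (X : ℤ → Ω → α) (n : ℕ) (ω : Ω) :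
    window (fun (i : ℤ) (f : ℤ → α) => f i) 0 n (fun i => X i ω) = window X 0 n ω := rfl

variable [MeasurableSpace Ω] [MeasurableSpace α] {X : ℤ → Ω → α}

theorem measurable_window (hX : ∀ i, Measurable (X i)) (t : ℤ) (n : ℕ) :
    Measurable (window X t n) :=
  measurable_pi_lambda _ fun _ => hX _

/-- The tuple `(X_{t+1}, …, X_{t+n})` along with the variables `Z_k` for `k ∈ F`. -/
def windowWith (X : ℤ → Ω → α) (Z : ℕ → Ω → Bool) (F : Finset ℕ) (t : ℤ) (n : ℕ) (ω : Ω) :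
    (Fin n → α) × (F → Bool) :=
  (window X t n ω, fun k => Z k ω)

theorem measurable_windowWith (hX : ∀ i, Measurable (X i)) {Z : ℕ → Ω → Bool}
    (hZ : ∀ k, Measurable (Z k)) (F : Finset ℕ) (t : ℤ) (n : ℕ) :
    Measurable (windowWith X Z F t n) :=
  (measurable_window hX t n).prodMk (measurable_pi_lambda _ fun _ => hZ _)

variable {P : Measure Ω}

theorem IsStationaryProcess.map_shift (hstat : IsStationaryProcess P X)
    (hX : ∀ i, Measurable (X i)) (t : ℕ) :
    P.map (fun ω (i : ℤ) => X (i + t) ω) = P.map (fun ω (i : ℤ) => X i ω) := by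
  induction t with
  | zero => simp
  | succ t ih =>
    have hS : Measurable fun (f : ℤ → α) (i : ℤ) => f (i + 1) :=
      measurable_pi_lambda _ fun _ => measurable_pi_apply _
    have h1 : P.map (fun ω (i : ℤ) => X (i + (t + 1 : ℕ)) ω) =
        (P.map (fun ω (i : ℤ) => X (i + t) ω)).map fun f (i : ℤ) => f (i + 1) := by
      rw [Measure.map_map hS (measurable_pi_lambda _ fun _ => hX _)]
      congr 1
      funext ω i
      simp only [Function.comp_apply]
      congr 1
      push_cast
      ring
    rw [h1, ih, Measure.map_map hS (measurable_pi_lambda _ fun _ => hX _)]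
    exact hstat

/-- A measurable event about a stationary process has the same probability after a shift. -/
theorem IsStationaryProcess.measure_shift (hstat : IsStationaryProcess P X)
    (hX : ∀ i, Measurable (X i)) (t : ℕ) {S : Set (ℤ → α)} (hS : MeasurableSet S) :
    P {ω | (fun i : ℤ => X (i + t) ω) ∈ S} = P {ω | (fun i : ℤ => X i ω) ∈ S} := by
  have h := congrArg (fun μ : Measure (ℤ → α) => μ S) (hstat.map_shift hX t)
  beta_reduce at h
  rwa [Measure.map_apply (measurable_pi_lambda _ fun _ => hX _) hS,
    Measure.map_apply (measurable_pi_lambda _ fun _ => hX _) hS] at h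

variable [Fintype α] [MeasurableSingletonClass α]

theorem measurableSet_block (hX : ∀ i, Measurable (X i)) (t : ℤ) (n : ℕ) (S : Set (List α)) :
    MeasurableSet {ω | block X t n ω ∈ S} :=
  measurable_window hX t n (MeasurableSet.of_discrete (s := {x | List.ofFn x ∈ S}))

/-- Two lengths are needed jointly: the window of interest, and a long one from which the facts are
predicted. -/
theorem IsStationaryProcess.measure_window (hstat : IsStationaryProcess P X)
    (hX : ∀ i, Measurable (X i)) (t m n : ℕ) (S : Set ((Fin m → α) × (Fin n → α))) :
    P {ω | (window X t m ω, window X t n ω) ∈ S} = P {ω | (window X 0 m ω, window X 0 n ω) ∈ S} := by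
  have hS : MeasurableSet {f : ℤ → α | (window (fun i f => f i) 0 m f,
      window (fun i f => f i) 0 n f) ∈ S} :=
    ((measurable_window (fun i => measurable_pi_apply i) 0 m).prodMk
      (measurable_window (fun i => measurable_pi_apply i) 0 n)) (MeasurableSet.of_discrete (s := S))
  have h := hstat.measure_shift hX t hS
  simp only [Set.mem_ofPred_eq, window_shift, window_coordinate] at h
  exact h

variable [IsProbabilityMeasure P]

theorem IsStationaryProcess.integral_window (hstat : IsStationaryProcess P X)
    (hX : ∀ i, Measurable (X i)) (t n : ℕ) (g : (Fin n → α) → ℝ) :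
    ∫ ω, g (window X t n ω) ∂P = ∫ ω, g (window X 0 n ω) ∂P := by
  rw [integral_comp_eq_sum (measurable_window hX t n),
    integral_comp_eq_sum (measurable_window hX 0 n)]
  refine Finset.sum_congr rfl fun y _ => ?_
  have h := hstat.measure_window hX t n n {q | q.1 = y}
  congr 1
  exact congrArg ENNReal.toReal h

variable {Z : ℕ → Ω → Bool} {s : ℕ → List α → Bool}

theorem IsStronglyNonergodicWith.tendsto_measureReal_ne (hZ : IsStronglyNonergodicWith P X Z s)
    (hX : ∀ i, Measurable (X i)) (t : ℤ) (k : ℕ) :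
    Tendsto (fun n : ℕ => P.real {ω | s k (block X t n ω) ≠ Z k ω}) atTop (𝓝 0) := by
  have h := (ENNReal.tendsto_toReal ENNReal.one_ne_top).comp (hZ.predictable t k)
  have h2 : Tendsto (fun n : ℕ => 1 - P.real {ω | s k (block X t n ω) = Z k ω}) atTop
      (𝓝 (1 - 1)) := tendsto_const_nhds.sub h
  rw [sub_self] at h2
  refine h2.congr fun n => ?_
  have hm : Measurable fun ω => s k (block X t n ω) :=
    (measurable_of_finite fun x : Fin n → α => s k (List.ofFn x)).comp (measurable_window hX t n)
  rw [← probReal_compl_eq_one_sub (measurableSet_eq_fun hm (hZ.measurable k))]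
  rfl

/-- The joint distribution of a window and the facts does not depend on the window's position. -/
theorem IsStronglyNonergodicWith.measureReal_windowWith (hZ : IsStronglyNonergodicWith P X Z s)
    (hX : ∀ i, Measurable (X i)) (hstat : IsStationaryProcess P X) (F : Finset ℕ) (t n : ℕ)
    (y : (Fin n → α) × (F → Bool)) :
    P.real (windowWith X Z F t n ⁻¹' {y}) = P.real (windowWith X Z F 0 n ⁻¹' {y}) := by
  -- Each fact is replaced by its prediction from `N` letters read at the same place. The event `B`
  -- then concerns the process alone and is shift-invariant in probability. The error event `E` has
  -- vanishing probability as `N` grows, at both places.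
  let B : ℤ → ℕ → Set Ω := fun t N =>
    {ω | window X t n ω = y.1 ∧ ∀ k : F, s k (block X t N ω) = y.2 k}
  let E : ℤ → ℕ → Set Ω := fun t N => ⋃ k ∈ F, {ω | s k (block X t N ω) ≠ Z k ω}
  have hB : ∀ N, P.real (B t N) = P.real (B 0 N) := fun N =>
    congrArg ENNReal.toReal (hstat.measure_window hX t n N
      {q | q.1 = y.1 ∧ ∀ k : F, s k (List.ofFn q.2) = y.2 k})
  have hE : ∀ t : ℤ, Tendsto (fun N => P.real (E t N)) atTop (𝓝 0) := by
    intro t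
    have h1 : Tendsto (fun N => ∑ k ∈ F, P.real {ω | s k (block X t N ω) ≠ Z k ω}) atTop
        (𝓝 (∑ k ∈ F, 0)) := tendsto_finsetSum _ fun k _ => hZ.tendsto_measureReal_ne hX t k
    rw [Finset.sum_const_zero] at h1
    exact squeeze_zero (fun _ => measureReal_nonneg) (fun N => measureReal_biUnion_finset_le _ _) h1
  have hAB : ∀ t N, windowWith X Z F t n ⁻¹' {y} ⊆ B t N ∪ E t N := by
    intro t N ω hω
    by_cases h : ω ∈ E t N
    · exact Or.inr h
    · left
      obtain rfl : windowWith X Z F t n ω = y := hω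
      refine ⟨rfl, fun k => ?_⟩
      by_contra hk
      exact h (Set.mem_iUnion₂.2 ⟨k, k.2, hk⟩)
  have hBA : ∀ t N, B t N ⊆ windowWith X Z F t n ⁻¹' {y} ∪ E t N := by
    intro t N ω hω
    by_cases h : ω ∈ E t N
    · exact Or.inr h
    · left
      refine Prod.ext hω.1 (funext fun k => ?_)
      change Z k ω = y.2 k
      rw [← hω.2 k]
      by_contra hk
      exact h (Set.mem_iUnion₂.2 ⟨k, k.2, Ne.symm hk⟩)
  have hAB' := fun t N => (measureReal_mono (μ := P) (hAB t N)).trans (measureReal_union_le _ _)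
  have hBA' := fun t N => (measureReal_mono (μ := P) (hBA t N)).trans (measureReal_union_le _ _)
  have hlim := (hE t).add (hE 0)
  rw [add_zero] at hlim
  apply le_antisymm
  · have h3 : Tendsto (fun N => P.real (windowWith X Z F 0 n ⁻¹' {y}) +
        (P.real (E t N) + P.real (E 0 N))) atTop (𝓝 (P.real (windowWith X Z F 0 n ⁻¹' {y}) + 0)) :=
      tendsto_const_nhds.add hlim
    rw [add_zero] at h3
    refine ge_of_tendsto' h3 fun N => ?_
    have h4 := hAB' t N
    have h5 := hBA' 0 N
    have h6 := hB N
    linarith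
  · have h3 : Tendsto (fun N => P.real (windowWith X Z F t n ⁻¹' {y}) +
        (P.real (E t N) + P.real (E 0 N))) atTop (𝓝 (P.real (windowWith X Z F t n ⁻¹' {y}) + 0)) :=
      tendsto_const_nhds.add hlim
    rw [add_zero] at h3
    refine ge_of_tendsto' h3 fun N => ?_
    have h4 := hAB' 0 N
    have h5 := hBA' t N
    have h6 := hB N
    linarith

theorem IsStronglyNonergodicWith.integral_windowWith (hZ : IsStronglyNonergodicWith P X Z s)
    (hX : ∀ i, Measurable (X i)) (hstat : IsStationaryProcess P X) (F : Finset ℕ) (t n : ℕ)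
    (g : (Fin n → α) × (F → Bool) → ℝ) :
    ∫ ω, g (windowWith X Z F t n ω) ∂P = ∫ ω, g (windowWith X Z F 0 n ω) ∂P := by
  rw [integral_comp_eq_sum (measurable_windowWith hX hZ.measurable F t n),
    integral_comp_eq_sum (measurable_windowWith hX hZ.measurable F 0 n)]
  refine Finset.sum_congr rfl fun y _ => ?_
  rw [hZ.measureReal_windowWith hX hstat]

theorem IsStronglyNonergodicWith.measureReal_facts {Ω α : Type*} [MeasurableSpace Ω]
    {P : Measure Ω} {X : ℤ → Ω → α} {Z : ℕ → Ω → Bool} {s : ℕ → List α → Bool}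
    (hZ : IsStronglyNonergodicWith P X Z s)
    (F : Finset ℕ) (z : F → Bool) :
    P.real {ω | (fun k : F => Z k ω) = z} = (2⁻¹ : ℝ) ^ F.card := by
  have h := hZ.indep.measure_inter_preimage_eq_mul F
    (sets := fun k => if h : k ∈ F then {z ⟨k, h⟩} else Set.univ) fun _ _ => MeasurableSet.of_discrete
  have h1 : {ω | (fun k : F => Z k ω) = z} =
      ⋂ k ∈ F, Z k ⁻¹' (if h : k ∈ F then {z ⟨k, h⟩} else Set.univ) := by
    ext ω
    simp only [Set.mem_ofPred_eq, Set.mem_iInter, Set.mem_preimage]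
    constructor
    · rintro rfl k hk
      simp [hk]
    · intro h
      funext k
      have := h k k.2
      simpa using this
  have h2 : ∀ k ∈ F, P (Z k ⁻¹' (if h : k ∈ F then {z ⟨k, h⟩} else Set.univ)) = 1 / 2 := by
    intro k hk
    rw [dif_pos hk]
    cases z ⟨k, hk⟩ with
    | false => exact hZ.prob_false k
    | true => exact hZ.prob_true k
  rw [measureReal_def, h1, h, Finset.prod_congr rfl h2, Finset.prod_const, ENNReal.toReal_pow]
  simp

end Windows

/-! ### Long repeats under finite energy. -/

section Repeats

variable {Ω α : Type*} [MeasurableSpace Ω] {P : Measure Ω} [IsProbabilityMeasure P]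
  [Fintype α] [MeasurableSpace α] [MeasurableSingletonClass α] {X : ℤ → Ω → α}

/-- The constants of a finite-energy process can be taken positive. -/
theorem IsFiniteEnergy.exists_pos (henergy : IsFiniteEnergy P X) (hX : ∀ i, Measurable (X i)) :
    ∃ c K : ℝ, 0 < c ∧ c < 1 ∧ 0 < K ∧ ∀ (t : ℤ) (u w : List α),
      P.real ({ω | block X t w.length ω = w} ∩ {ω | block X (t + w.length) u.length ω = u}) ≤
        K * c ^ u.length * P.real {ω | block X t w.length ω = w} := by
  obtain ⟨c, K, hc, h⟩ := henergy
  have hmeas : ∀ (t : ℤ) (w : List α), MeasurableSet {ω | block X t w.length ω = w} :=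
    fun t w => measurableSet_block hX t w.length {w}
  have h0 : ∀ (t : ℤ) (u w : List α), 0 < P.real {ω | block X t w.length ω = w} →
      P.real ({ω | block X t w.length ω = w} ∩ {ω | block X (t + w.length) u.length ω = u}) ≤
        K * c ^ u.length * P.real {ω | block X t w.length ω = w} := by
    intro t u w hw
    have h1 := h t u w (ENNReal.toReal_pos_iff.1 hw).1
    rw [measureReal_def, cond_apply (hmeas t w), ENNReal.toReal_mul, ENNReal.toReal_inv] at h1
    rw [← measureReal_def, ← measureReal_def, inv_mul_le_iff₀ hw] at h1
    linarith
  have hnil : ∀ t : ℤ, {ω | block X t ([] : List α).length ω = []} = Set.univ := by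
    intro t
    ext ω
    simp [block]
  -- Conditioning on the empty string bounds unconditional probabilities. The empty `u` then gives
  -- `1 ≤ K`, and a letter of positive probability gives `0 < c`.
  have h1 : ∀ u : List α, P.real {ω | block X 0 u.length ω = u} ≤ K * c ^ u.length := by
    intro u
    have h2 := h0 0 u []
    rw [hnil, Set.univ_inter, probReal_univ, mul_one] at h2
    simpa using h2 one_pos
  have hK : 0 < K := by
    have := h1 []
    rw [hnil] at this
    simp at this
    linarith
  have hc0 : 0 < c := by
    obtain ⟨x, hx⟩ : ∃ x : Fin 1 → α, 0 < P.real (window X 0 1 ⁻¹' {x}) := by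
      by_contra! hcon
      have h2 := sum_measureReal_preimage_singleton_eq_one (P := P) (measurable_window hX 0 1)
      have h3 := Finset.sum_nonpos fun x (_ : x ∈ Finset.univ) => hcon x
      linarith
    have h2 := h1 (List.ofFn x)
    have h3 : {ω | block X 0 (List.ofFn x).length ω = List.ofFn x} = window X 0 1 ⁻¹' {x} := by
      ext ω
      rw [List.length_ofFn]
      exact List.ofFn_injective.eq_iff
    rw [h3, List.length_ofFn, pow_one] at h2
    exact pos_of_mul_pos_right (hx.trans_le h2) hK.le
  refine ⟨c, K, hc0, hc, hK, fun t u w => ?_⟩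
  rcases (measureReal_nonneg (μ := P) (s := {ω | block X t w.length ω = w})).eq_or_lt with hw | hw
  · rw [← hw, mul_zero, hw]
    exact measureReal_mono Set.inter_subset_left
  · exact h0 t u w hw

/-- Agreement with the shift by `d` is periodicity, so the first `d` values determine the rest. This
handles overlapping repeats. -/
theorem eq_of_forall_eq_sub {β : Type*} {f : ℕ → β} {d k : ℕ} (hd : 0 < d)
    (h : ∀ i < k, f (d + i) = f i) : ∀ i < k, f (d + i) = f (i % d) := by
  intro i
  induction i using Nat.strong_induction_on with
  | _ i ih =>
    intro hi
    rw [h i hi]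
    rcases lt_or_ge i d with hid | hid
    · rw [Nat.mod_eq_of_lt hid]
    · obtain ⟨j, rfl⟩ := Nat.exists_eq_add_of_le hid
      rw [ih j (by omega) (by omega), Nat.add_mod_left]

/-- In a process of finite energy, a block of length `k` is unlikely to equal the block found `d`
positions earlier, even if the two overlap. -/
theorem measureReal_shifted_eq_le (hX : ∀ i, Measurable (X i)) {c K : ℝ}
    (h : ∀ (t : ℤ) (u w : List α),
      P.real ({ω | block X t w.length ω = w} ∩ {ω | block X (t + w.length) u.length ω = u}) ≤
        K * c ^ u.length * P.real {ω | block X t w.length ω = w})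
    (p : ℤ) {d : ℕ} (hd : 0 < d) (k : ℕ) :
    P.real {ω | ∀ i < k, X (p + 1 + (d + i : ℕ)) ω = X (p + 1 + (i : ℕ)) ω} ≤ K * c ^ k := by
  -- Given the first `d` letters `w`, the event forces the next `k` letters to be the periodic
  -- continuation of `w`: a single string, to which finite energy applies.
  let u : (Fin d → α) → List α := fun w => List.ofFn fun i : Fin k => w ⟨i % d, Nat.mod_lt _ hd⟩
  have hsub : {ω | ∀ i < k, X (p + 1 + (d + i : ℕ)) ω = X (p + 1 + (i : ℕ)) ω} ⊆
      ⋃ w ∈ (Finset.univ : Finset (Fin d → α)), ({ω | block X p (List.ofFn w).length ω = List.ofFn w}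
        ∩ {ω | block X (p + (List.ofFn w).length) (u w).length ω = u w}) := by
    intro ω hω
    refine Set.mem_iUnion₂.2 ⟨window X p d ω, Finset.mem_univ _, ?_, ?_⟩
    · change block X p _ ω = _
      rw [List.length_ofFn]
      rfl
    · have h1 := eq_of_forall_eq_sub (f := fun i : ℕ => X (p + 1 + (i : ℕ)) ω) hd hω
      change block X _ _ ω = _
      rw [List.length_ofFn, List.length_ofFn]
      refine congrArg List.ofFn (funext fun i => ?_)
      refine Eq.trans ?_ (h1 i i.2)
      congr 1
      push_cast
      ring
  refine (measureReal_mono hsub (measure_ne_top _ _)).trans ((measureReal_biUnion_finset_le _ _).trans ?_)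
  refine (Finset.sum_le_sum fun w _ => h p (u w) (List.ofFn w)).trans ?_
  have h2 : ∀ w : Fin d → α, {ω | block X p (List.ofFn w).length ω = List.ofFn w} =
      window X p d ⁻¹' {w} := by
    intro w
    ext ω
    rw [List.length_ofFn]
    exact List.ofFn_injective.eq_iff
  simp only [h2]
  have h3 : ∀ w, (u w).length = k := fun w => List.length_ofFn
  simp only [h3]
  rw [← Finset.mul_sum, sum_measureReal_preimage_singleton_eq_one (measurable_window hX p d), mul_one]

/-- Long repeats are unlikely in a process of finite energy. -/
theorem measureReal_exists_long_repeat_le (hX : ∀ i, Measurable (X i)) {c K : ℝ}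
    (h : ∀ (t : ℤ) (u w : List α),
      P.real ({ω | block X t w.length ω = w} ∩ {ω | block X (t + w.length) u.length ω = u}) ≤
        K * c ^ u.length * P.real {ω | block X t w.length ω = w}) (N L : ℕ) :
    P.real {ω | ¬ ∀ s, IsRepeatedIn s (block X 0 N ω) → s.length ≤ L} ≤
      N ^ 2 * (K * c ^ (L + 1)) := by
  -- A pair records the first position and the gap minus one; only the first `L + 1` letters of the
  -- repeat are used. The `N ^ 2` pairs give the union bound.
  have hsub : {ω | ¬ ∀ s, IsRepeatedIn s (block X 0 N ω) → s.length ≤ L} ⊆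
      ⋃ q ∈ Finset.range N ×ˢ Finset.range N,
        {ω | ∀ i < L + 1, X ((q.1 : ℤ) + 1 + (q.2 + 1 + i : ℕ)) ω = X (q.1 + 1 + (i : ℕ)) ω} := by
    intro ω hω
    have hω' : ¬ ∀ s, IsRepeatedIn s (block X 0 N ω) → s.length ≤ L := hω
    push Not at hω'
    obtain ⟨s, ⟨p, q, hpq, hp, hq⟩, hs⟩ := hω'
    wlog hlt : p < q generalizing p q
    · exact this q p hpq.symm hq hp (by omega)
    have hlen : ∀ p, s <+: (block X 0 N ω).drop p → p + s.length ≤ N := by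
      intro p hp
      have := hp.length_le
      rw [List.length_drop, length_block] at this
      omega
    have hlp := hlen p hp
    have hlq := hlen q hq
    have hget : ∀ p, s <+: (block X 0 N ω).drop p → ∀ i (hi : i < s.length),
        s[i] = X ((p : ℤ) + 1 + (i : ℕ)) ω := by
      intro p hp i hi
      rw [hp.getElem hi]
      simp only [List.getElem_drop, block, List.getElem_ofFn]
      congr 1
      push_cast
      ring
    refine Set.mem_iUnion₂.2 ⟨(p, q - p - 1), ?_, ?_⟩
    · rw [Finset.mem_product, Finset.mem_range, Finset.mem_range]
      constructor <;> simp only <;> omega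
    · intro i hi
      have h1 := hget p hp i (by omega)
      have h2 := hget q hq i (by omega)
      rw [← h1, h2]
      congr 1
      simp only
      omega
  refine (measureReal_mono hsub (measure_ne_top _ _)).trans ((measureReal_biUnion_finset_le _ _).trans ?_)
  refine (Finset.sum_le_sum fun q _ =>
    measureReal_shifted_eq_le hX h (q.1 : ℤ) (Nat.succ_pos q.2) (L + 1)).trans ?_
  rw [Finset.sum_const, Finset.card_product, Finset.card_range, nsmul_eq_mul]
  push_cast
  exact le_of_eq (by ring)

end Repeats

/-! ### Coding by a ranked dictionary of block sequences. -/

/-- The elements of a finite type can be ranked so that the ranks are at most the inverse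
probabilities. -/
theorem exists_rank_mul_le_one {T : Type*} [Fintype T] (Q : T → ℝ) (hQ : ∀ t, 0 ≤ Q t)
    (hsum : ∑ t, Q t ≤ 1) :
    ∃ idx : T ≃ Fin (Fintype.card T), ∀ t, (((idx t).val : ℝ) + 1) * Q t ≤ 1 := by
  let e := Fintype.equivFin T
  -- The sign makes the sort decreasing in probability: the element of rank `i` and those before it
  -- all weigh at least `Q t`, whence `(i + 1) Q t ≤ 1`.
  let f : Fin (Fintype.card T) → ℝ := fun i => -Q (e.symm i)
  have hmono := Tuple.monotone_sort f
  refine ⟨e.trans (Tuple.sort f).symm, fun t => ?_⟩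
  set i := (e.trans (Tuple.sort f).symm) t with hi
  have ht : t = e.symm (Tuple.sort f i) := by simp [hi]
  have h1 : ∀ j ∈ Finset.Iic i, Q t ≤ Q (e.symm (Tuple.sort f j)) := by
    intro j hj
    have h2 : f (Tuple.sort f j) ≤ f (Tuple.sort f i) := hmono (Finset.mem_Iic.1 hj)
    rw [ht]
    simpa [f] using h2
  have h2 := Finset.card_nsmul_le_sum _ _ _ h1
  rw [Fin.card_Iic, nsmul_eq_mul] at h2
  push_cast at h2
  refine h2.trans (le_trans ?_ hsum)
  rw [← Equiv.sum_comp ((Tuple.sort f).trans e.symm)]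
  exact Finset.sum_le_sum_of_subset_of_nonneg (Finset.subset_univ _) fun _ _ _ => hQ _

/-- The concatenation of a tuple of tuples, as a string. -/
def flattenTuple {α : Type*} {m n : ℕ} (u : Fin m → Fin n → α) : List α :=
  (List.ofFn fun j => List.ofFn (u j)).flatten

/-- Upper bound on the code length of a minimal grammar transform by means of a dictionary for
sequences of independent blocks. -/
theorem IsMinimalFor.codeLength_le_sum_log {α : Type*} [Fintype α]
    {Γ : List α → AdmissibleGrammar α} {e : α ≃ Fin (Fintype.card α)} {b : ℕ → List Bool}
    (h : IsMinimalFor Γ e b) {ε C : ℝ} (hε : 0 < ε)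
    (hC : ∀ x : ℕ, 1 ≤ x → ((b (Fintype.card α + 1 + x)).length : ℝ) * Real.log 2 ≤
      (1 + ε) * Real.log x + C) {r m n : ℕ} {q : (Fin n → α) → ℝ} (hq : ∀ x, 0 ≤ q x)
    (hsum : ∑ x, q x = 1) (u : Fin r → Fin m → Fin n → α) (hu : ∀ i j, 0 < q (u i j))
    (hne : (List.ofFn u).flatMap flattenTuple ≠ []) :
    ((Γ ((List.ofFn u).flatMap flattenTuple)).codeLength e b : ℝ) * Real.log 2 ≤
      ∑ i, ((1 + ε) * (∑ j, -Real.log (q (u i j))) + C) +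
        ((∑ t : Fin m → Fin n → α, (flattenTuple t).length) + Fintype.card (Fin m → Fin n → α) + 1 : ℕ)
          * ((b (Fintype.card α + 1)).length : ℝ) * Real.log 2 := by
  classical
  have hlog2 : 0 < Real.log 2 := Real.log_pos (by norm_num)
  -- Sequences of `m` blocks are ranked by product weight, so the logarithm of a rank is at most a
  -- sum of `-log q`. The additive constant `C` is paid once per sequence rather than once per
  -- block.
  obtain ⟨idx, hidx⟩ := exists_rank_mul_le_one (fun t : Fin m → Fin n → α => ∏ j, q (t j))
    (fun t => Finset.prod_nonneg fun j _ => hq _) (by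
      have h1 := Finset.prod_univ_sum (fun _ : Fin m => (Finset.univ : Finset (Fin n → α)))
        fun _ x => q x
      rw [Fintype.piFinset_univ] at h1
      rw [← h1]
      simp [hsum])
  have h1 := h.codeLength_le_ofDictionary flattenTuple idx (List.ofFn u) hne
  rw [List.map_ofFn, List.sum_ofFn] at h1
  have h2 : ((Γ ((List.ofFn u).flatMap flattenTuple)).codeLength e b : ℝ) ≤ _ := Nat.cast_le.2 h1
  refine (mul_le_mul_of_nonneg_right h2 hlog2.le).trans ?_
  rw [Nat.cast_add, add_mul, Nat.cast_mul, Nat.cast_sum, Finset.sum_mul]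
  gcongr with i _
  simp only [Function.comp_apply]
  refine (hC _ (Nat.succ_pos _)).trans ?_
  gcongr
  have hpos : 0 < ∏ j, q (u i j) := Finset.prod_pos fun j _ => hu i j
  have h3 := hidx (u i)
  rw [← le_div_iff₀ hpos] at h3
  rw [Finset.sum_neg_distrib, ← Real.log_prod fun j _ => (hu i j).ne', ← Real.log_inv, ← one_div]
  apply Real.log_le_log
  · positivity
  · push_cast
    exact h3

theorem block_mul {Ω α : Type*} (X : ℤ → Ω → α) (t : ℤ) (m n : ℕ) (ω : Ω) :
    block X t (m * n) ω = flattenTuple fun j : Fin m => window X (t + (j * n : ℕ)) n ω := by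
  rw [block, List.ofFn_mul, flattenTuple]
  congr 2
  funext i
  congr 1
  funext j
  simp only [window]
  congr 1
  push_cast
  ring

theorem block_mul_mul {Ω α : Type*} (X : ℤ → Ω → α) (r m n : ℕ) (ω : Ω) :
    block X 0 (r * (m * n)) ω = (List.ofFn fun (i : Fin r) (j : Fin m) =>
      window X ((i * (m * n) + j * n : ℕ) : ℤ) n ω).flatMap flattenTuple := by
  rw [block_mul, flattenTuple, List.flatMap, List.map_ofFn]
  congr 2
  funext i
  rw [← block_eq_ofFn, block_mul]
  simp only [Function.comp_apply]
  congr 1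
  funext j
  congr 1
  push_cast
  ring

/-! ### Code length against entropy given the facts. -/

section Entropy

variable {Ω α : Type*} [MeasurableSpace Ω] {P : Measure Ω} [IsProbabilityMeasure P]
  [Fintype α] [MeasurableSpace α] [MeasurableSingletonClass α] {X : ℤ → Ω → α}
  {Z : ℕ → Ω → Bool} {s : ℕ → List α → Bool}

variable (P X Z) in
/-- The entropy of `X_1, …, X_n` given the equidistributed binary variables `Z_k`, `k ∈ F`. -/
noncomputable def entropyGiven (F : Finset ℕ) (n : ℕ) : ℝ :=
  -∫ ω, Real.log (P.real (windowWith X Z F 0 n ⁻¹' {windowWith X Z F 0 n ω})) ∂P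
    - F.card * Real.log 2

variable {Γ : List α → AdmissibleGrammar α} {e : α ≃ Fin (Fintype.card α)} {b : ℕ → List Bool}

theorem integrable_block (hX : ∀ i, Measurable (X i)) (t : ℤ) (n : ℕ) (f : List α → ℝ) :
    Integrable (fun ω => f (block X t n ω)) P :=
  integrable_comp_of_finite (measurable_window hX t n) fun x => f (List.ofFn x)

/-- The expected code length exceeds the entropy given the facts by an amount proportional to the
number of predictable facts. -/
theorem entropyGiven_add_le (h : IsMinimalFor Γ e b) (hX : ∀ i, Measurable (X i))
    (hZ : IsStronglyNonergodicWith P X Z s) {δ : ℝ} (hδ : δ ∈ Set.Ioo (1 / 2 : ℝ) 1)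
    (F : Finset ℕ) {n : ℕ} (hn : n ≠ 0)
    (hF : ∀ k ∈ F, δ ≤ P.real {ω | s k (block X 0 n ω) = Z k ω}) :
    entropyGiven P X Z F n + F.card * (Real.log 2 - Real.binEntropy δ) ≤
      Real.log 2 * ∫ ω, ((Γ (block X 0 n ω)).codeLength e b : ℝ) ∂P := by
  classical
  have hδ0 : 0 < δ := by linarith [hδ.1]
  have hδ1 : 0 < 1 - δ := by linarith [hδ.2]
  have hY := measurable_windowWith hX hZ.measurable F 0 n
  let g : (Fin n → α) × (F → Bool) → F → ℝ := fun y k =>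
    if s k (List.ofFn y.1) = y.2 k then δ else 1 - δ
  have hg : ∀ y k, 0 < g y k := by
    intro y k
    simp only [g]
    split_ifs <;> assumption
  -- The weight `r` is the code's Kraft weight times independent guesses that trust each predictor
  -- with probability `δ`; the guesses sum to 1 over the facts.
  let r : (Fin n → α) × (F → Bool) → ℝ := fun y =>
    (2⁻¹ : ℝ) ^ ((Γ (List.ofFn y.1)).codeLength e b) * ∏ k, g y k
  have hr : ∀ y, 0 < r y := fun y => mul_pos (by positivity) (Finset.prod_pos fun k _ => hg y k)
  have hsum : ∑ y, r y ≤ 1 := by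
    rw [Fintype.sum_prod_type]
    have h1 : ∀ x : Fin n → α, ∑ z : F → Bool, r (x, z) =
        (2⁻¹ : ℝ) ^ ((Γ (List.ofFn x)).codeLength e b) := by
      intro x
      simp only [r]
      rw [← Finset.mul_sum]
      have h2 := Finset.prod_univ_sum (fun _ : F => (Finset.univ : Finset Bool))
        fun k z => if s k (List.ofFn x) = z then δ else 1 - δ
      rw [Fintype.piFinset_univ] at h2
      rw [← h2, Finset.prod_eq_one, mul_one]
      intro k _
      rw [Fintype.sum_bool]
      cases s k (List.ofFn x) <;> simp
    rw [Finset.sum_congr rfl fun x _ => h1 x]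
    exact h.transform.sum_two_inv_pow_codeLength_le_one e h.code hn
  have hgibbs := integral_log_le_integral_log_prob (P := P) hY hr hsum
  have hlogr : ∀ y, Real.log (r y) =
      -(Real.log 2 * ((Γ (List.ofFn y.1)).codeLength e b : ℝ)) + ∑ k, Real.log (g y k) := by
    intro y
    simp only [r]
    rw [Real.log_mul (by positivity) (Finset.prod_pos fun k _ => hg y k).ne',
      Real.log_prod fun k _ => (hg y k).ne', Real.log_pow, Real.log_inv]
    ring
  -- A prediction is right with probability at least `δ`, and `log δ ≥ log (1 - δ)`, so the mean is
  -- smallest at accuracy exactly `δ`.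
  have hint : ∀ k : F, -Real.binEntropy δ ≤ ∫ ω, Real.log (g (windowWith X Z F 0 n ω) k) ∂P := by
    intro k
    have hm : Measurable fun ω => s k (block X 0 n ω) :=
      (measurable_of_finite fun x : Fin n → α => s k (List.ofFn x)).comp (measurable_window hX 0 n)
    have hS : MeasurableSet {ω | s k (block X 0 n ω) = Z k ω} :=
      measurableSet_eq_fun hm (hZ.measurable k)
    have h1 : ∀ ω, Real.log (g (windowWith X Z F 0 n ω) k) = Real.log (1 - δ) +
        {ω | s k (block X 0 n ω) = Z k ω}.indicator
          (fun _ => Real.log δ - Real.log (1 - δ)) ω := by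
      intro ω
      by_cases hω : s k (block X 0 n ω) = Z k ω
      · have h2 : g (windowWith X Z F 0 n ω) k = δ := if_pos hω
        rw [h2, Set.indicator_of_mem (show ω ∈ {ω | s k (block X 0 n ω) = Z k ω} from hω)]
        ring
      · have h2 : g (windowWith X Z F 0 n ω) k = 1 - δ := if_neg hω
        rw [h2, Set.indicator_of_notMem (show ω ∉ {ω | s k (block X 0 n ω) = Z k ω} from hω)]
        ring
    simp only [h1]
    rw [integral_add (integrable_const _) ((integrable_const _).indicator hS),
      integral_indicator_const _ hS, integral_const, probReal_univ, one_smul, smul_eq_mul,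
      Real.binEntropy_eq_negMulLog_add_negMulLog_one_sub, Real.negMulLog, Real.negMulLog]
    have h2 : Real.log (1 - δ) ≤ Real.log δ := Real.log_le_log hδ1 (by linarith [hδ.1])
    nlinarith [hF k k.2]
  have h3 : ∫ ω, Real.log (r (windowWith X Z F 0 n ω)) ∂P =
      -(Real.log 2 * ∫ ω, ((Γ (block X 0 n ω)).codeLength e b : ℝ) ∂P) +
        ∑ k, ∫ ω, Real.log (g (windowWith X Z F 0 n ω) k) ∂P := by
    simp only [hlogr]
    rw [integral_add
      (integrable_comp_of_finite hY fun y =>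
        -(Real.log 2 * ((Γ (List.ofFn y.1)).codeLength e b : ℝ)))
      (integrable_comp_of_finite hY fun y => ∑ k, Real.log (g y k)), integral_neg,
      integral_const_mul, integral_finsetSum _ fun k _ =>
        integrable_comp_of_finite hY fun y => Real.log (g y k)]
    rfl
  have h4 := Finset.sum_le_sum fun k (_ : k ∈ (Finset.univ : Finset F)) => hint k
  rw [Finset.sum_const, Finset.card_univ, Fintype.card_coe, nsmul_eq_mul] at h4
  rw [h3] at hgibbs
  rw [entropyGiven]
  linarith

/-- The code of a minimal grammar transform is universal, even relative to the facts. -/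
theorem codeLength_le_entropyGiven (h : IsMinimalFor Γ e b) (hX : ∀ i, Measurable (X i))
    (hstat : IsStationaryProcess P X) (hZ : IsStronglyNonergodicWith P X Z s) {ε : ℝ} (hε : 0 < ε)
    (F : Finset ℕ) {n : ℕ} (hn : n ≠ 0) :
    ∃ C : ℝ, ∀ m : ℕ, m ≠ 0 → ∃ C' : ℝ, ∀ r : ℕ, r ≠ 0 →
      Real.log 2 * ∫ ω, ((Γ (block X 0 (r * (m * n)) ω)).codeLength e b : ℝ) ∂P ≤
        r * ((1 + ε) * (m * entropyGiven P X Z F n) + C) + C' := by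
  -- `C` depends on neither `m` nor `r`, and `C'` (the cost of the dictionary itself) not on `r`.
  -- Both vanish per letter when first `r` and then `m` grows.
  obtain ⟨C, -, hC⟩ := h.code.exists_length_le (Fintype.card α + 1) hε
  refine ⟨C, fun m hm => ⟨((∑ t : Fin m → Fin n → α, (flattenTuple t).length) +
    Fintype.card (Fin m → Fin n → α) + 1 : ℕ) * ((b (Fintype.card α + 1)).length : ℝ) * Real.log 2,
    fun r hr => ?_⟩⟩
  -- The conditional law of the window given the facts, each configuration `z` having probability `2
  -- ^ (-|F|)`.
  let q : (F → Bool) → (Fin n → α) → ℝ := fun z x =>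
    2 ^ F.card * P.real (windowWith X Z F 0 n ⁻¹' {(x, z)})
  have hq : ∀ z x, 0 ≤ q z x := fun z x => by positivity
  have hsum : ∀ z, ∑ x, q z x = 1 := by
    intro z
    have h1 := hZ.measureReal_facts F z
    have h2 : {ω | (fun k : F => Z k ω) = z} =
        ⋃ x ∈ (Finset.univ : Finset (Fin n → α)), windowWith X Z F 0 n ⁻¹' {(x, z)} := by
      ext ω
      simp [windowWith]
    rw [h2, measureReal_biUnion_finset] at h1
    · simp only [q]
      rw [← Finset.mul_sum, h1, ← mul_pow]
      norm_num
    · intro x _ y _ hxy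
      exact Set.disjoint_left.2 fun ω hω hω' => hxy (Prod.ext_iff.1 (hω.symm.trans hω')).1
    · exact fun x _ => measurable_windowWith hX hZ.measurable F 0 n (measurableSet_singleton _)
  let l : (Fin n → α) × (F → Bool) → ℝ := fun y => -Real.log (q y.2 y.1)
  have hint : ∀ t : ℕ, ∫ ω, l (windowWith X Z F t n ω) ∂P = entropyGiven P X Z F n := by
    intro t
    rw [hZ.integral_windowWith hX hstat]
    have h1 : ∀ᵐ ω ∂P, l (windowWith X Z F 0 n ω) =
        -Real.log (P.real (windowWith X Z F 0 n ⁻¹' {windowWith X Z F 0 n ω}))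
          - F.card * Real.log 2 := by
      filter_upwards [ae_measureReal_preimage_singleton_pos (P := P) (windowWith X Z F 0 n)]
        with ω hω
      simp only [l, q, Prod.mk.eta]
      rw [Real.log_mul (by positivity) hω.ne', Real.log_pow]
      ring
    rw [integral_congr_ae h1, integral_sub, integral_neg, integral_const, probReal_univ, one_smul,
      entropyGiven]
    · exact (integrable_comp_of_finite (measurable_windowWith hX hZ.measurable F 0 n) fun y =>
        Real.log (P.real (windowWith X Z F 0 n ⁻¹' {y}))).neg
    · exact integrable_const _
  have hl : ∀ t : ℕ, Integrable (fun ω => l (windowWith X Z F t n ω)) P := fun t =>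
    integrable_comp_of_finite (measurable_windowWith hX hZ.measurable F t n) l
  have hpos : ∀ t : ℕ, ∀ᵐ ω ∂P, 0 < q (fun k => Z k ω) (window X t n ω) := by
    intro t
    filter_upwards [ae_measureReal_preimage_singleton_pos (P := P) (windowWith X Z F t n)] with ω hω
    rw [hZ.measureReal_windowWith hX hstat] at hω
    exact mul_pos (by positivity) hω
  -- The dictionary is ranked with knowledge of the actual facts at `ω`. Nothing is paid for this,
  -- since a minimal grammar competes with every grammar of the same string.
  have hae : ∀ᵐ ω ∂P, ((Γ (block X 0 (r * (m * n)) ω)).codeLength e b : ℝ) * Real.log 2 ≤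
      ∑ i : Fin r, ((1 + ε) * (∑ j : Fin m, l (windowWith X Z F (i * (m * n) + j * n : ℕ) n ω)) + C)
        + ((∑ t : Fin m → Fin n → α, (flattenTuple t).length) +
          Fintype.card (Fin m → Fin n → α) + 1 : ℕ) * ((b (Fintype.card α + 1)).length : ℝ)
            * Real.log 2 := by
    filter_upwards [ae_all_iff.2 hpos] with ω hω
    have hne := block_ne_nil X 0 (mul_ne_zero hr (mul_ne_zero hm hn)) ω
    rw [block_mul_mul] at hne ⊢
    exact h.codeLength_le_sum_log hε hC (hq fun k => Z k ω) (hsum _) _ (fun i j => hω _) hne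
  have hI : ∀ i : Fin r, Integrable (fun ω =>
      (1 + ε) * (∑ j : Fin m, l (windowWith X Z F (i * (m * n) + j * n : ℕ) n ω)) + C) P := fun i =>
    ((integrable_finsetSum _ fun j _ => hl _).const_mul _).add (integrable_const _)
  have hmono := integral_mono_ae
    ((integrable_block hX 0 (r * (m * n)) fun w => ((Γ w).codeLength e b : ℝ)).mul_const _)
    ((integrable_finsetSum _ fun i _ => hI i).add (integrable_const _)) hae
  rw [integral_mul_const] at hmono
  refine (mul_comm _ _).trans_le (hmono.trans (le_of_eq ?_))
  simp only [Pi.add_apply]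
  rw [integral_add (integrable_finsetSum _ fun i _ => hI i) (integrable_const _),
    integral_finsetSum _ fun i _ => hI i, integral_const, probReal_univ, one_smul]
  congr 1
  have h2 : ∀ i : Fin r, ∫ ω, ((1 + ε) *
      (∑ j : Fin m, l (windowWith X Z F (i * (m * n) + j * n : ℕ) n ω)) + C) ∂P =
      (1 + ε) * (m * entropyGiven P X Z F n) + C := by
    intro i
    rw [integral_add ((integrable_finsetSum _ fun j _ => hl _).const_mul _) (integrable_const _),
      integral_const_mul, integral_finsetSum _ fun j _ => hl _, integral_const, probReal_univ,
      one_smul, Finset.sum_congr rfl fun (j : Fin m) _ => hint (i * (m * n) + j * n),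
      Finset.sum_const, Finset.card_univ, Fintype.card_fin, nsmul_eq_mul]
  rw [Finset.sum_congr rfl fun i _ => h2 i, Finset.sum_const, Finset.card_univ, Fintype.card_fin,
    nsmul_eq_mul]

end Entropy

/-! ### Near superadditivity of the code length under doubling. -/

section Doubling

variable {Ω α : Type*} [MeasurableSpace Ω] {P : Measure Ω} [IsProbabilityMeasure P]
  [Fintype α] [MeasurableSpace α] [MeasurableSingletonClass α] {X : ℤ → Ω → α}
  {Γ : List α → AdmissibleGrammar α} {e : α ≃ Fin (Fintype.card α)} {b : ℕ → List Bool}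

/-- In the absence of repeats of more than logarithmic length, the code is nearly superadditive up
to the vocabulary size times a logarithm. -/
theorem IsMinimalFor.exists_codeLength_add_le {α : Type*} [Fintype α]
    {Γ : List α → AdmissibleGrammar α} {e : α ≃ Fin (Fintype.card α)} {b : ℕ → List Bool}
    (h : IsMinimalFor Γ e b) {A : ℝ} (hA : 0 ≤ A) :
    ∃ C : ℝ, 0 ≤ C ∧ ∀ u v : List α, u ≠ [] → v ≠ [] → ∀ n : ℕ, 2 ≤ n → (u ++ v).length = n →
      (∀ s, IsRepeatedIn s (u ++ v) → s.length ≤ ⌈A * Real.log n⌉₊) →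
      ((Γ u).codeLength e b : ℝ) + (Γ v).codeLength e b ≤ (Γ (u ++ v)).codeLength e b
        + C * Real.log n * (Γ (u ++ v)).vocab := by
  obtain ⟨C₀, hC₀, hC⟩ := h.code.exists_length_le (Fintype.card α + 1) one_pos
  set B : ℝ := ((b (Fintype.card α + 1)).length : ℝ) with hB
  have hB1 : 1 ≤ B := by
    rw [hB]
    exact_mod_cast h.code.length_pos _
  have hlog2 : 0 < Real.log 2 := Real.log_pos (by norm_num)
  have hlogB : 0 ≤ Real.log (2 * B) := Real.log_nonneg (by linarith)
  -- The first summand bounds a reference, by the length estimate with `ε = 1` and `V ≤ (n + 1) B ≤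
  -- 2 B n`. The second bounds the `L + 1` letters. Additive constants are absorbed into `log n ≥
  -- log 2`.
  refine ⟨(2 + (2 * Real.log (2 * B) + C₀) / Real.log 2) / Real.log 2
    + (A + 2 / Real.log 2) * B, by positivity, fun u v hu hv n hn hlen hrep => ?_⟩
  have hn' : (2 : ℝ) ≤ n := by exact_mod_cast hn
  have hlogn : Real.log 2 ≤ Real.log n := Real.log_le_log (by norm_num) hn'
  have hlogn0 : 0 < Real.log n := hlog2.trans_le hlogn
  have huv : u ++ v ≠ [] := by simp [hu]
  have h1 := h.codeLength_add_le hu hv hrep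
  have h1' : ((Γ u).codeLength e b : ℝ) + (Γ v).codeLength e b ≤ (Γ (u ++ v)).codeLength e b
      + (Γ (u ++ v)).vocab * (((b (Fintype.card α + 1 + (Γ (u ++ v)).vocab)).length : ℝ)
        + (⌈A * Real.log n⌉₊ + 1) * B) := by
    rw [hB]
    exact_mod_cast h1
  have hV1 : 1 ≤ (Γ (u ++ v)).vocab := (Γ (u ++ v)).vocab_pos
  have hV2 : ((Γ (u ++ v)).vocab : ℝ) ≤ (n + 1) * B := by
    have := h.vocab_le huv
    rw [hlen] at this
    rw [hB]
    exact_mod_cast this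
  have hV3 : Real.log ((Γ (u ++ v)).vocab) ≤ Real.log n + Real.log (2 * B) := by
    rw [← Real.log_mul (by positivity) (by positivity)]
    apply Real.log_le_log
    · exact_mod_cast hV1
    · nlinarith
  have hconst : ∀ x : ℝ, 0 ≤ x → x ≤ x / Real.log 2 * Real.log n := by
    intro x hx
    calc x = x / Real.log 2 * Real.log 2 := by field_simp
      _ ≤ x / Real.log 2 * Real.log n := by gcongr
  have h2 : ((b (Fintype.card α + 1 + (Γ (u ++ v)).vocab)).length : ℝ) ≤
      (2 + (2 * Real.log (2 * B) + C₀) / Real.log 2) / Real.log 2 * Real.log n := by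
    have h3 := hC _ hV1
    have h4 := hconst (2 * Real.log (2 * B) + C₀) (by positivity)
    rw [div_mul_eq_mul_div, le_div_iff₀ hlog2]
    linarith
  have h3 : ((⌈A * Real.log n⌉₊ : ℝ) + 1) * B ≤ (A + 2 / Real.log 2) * B * Real.log n := by
    have h4 := (Nat.ceil_lt_add_one (show 0 ≤ A * Real.log n by positivity)).le
    have h5 := hconst 2 (by norm_num)
    calc ((⌈A * Real.log n⌉₊ : ℝ) + 1) * B ≤ ((A + 2 / Real.log 2) * Real.log n) * B := by
          gcongr
          linarith
      _ = _ := by ring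
  refine h1'.trans ?_
  rw [add_le_add_iff_left, mul_comm]
  have hV0 : (0 : ℝ) ≤ (Γ (u ++ v)).vocab := Nat.cast_nonneg _
  apply mul_le_mul_of_nonneg_right _ hV0
  linarith

/-- The expected code length is nearly superadditive, up to the expected vocabulary size times a
logarithm. -/
theorem IsMinimalFor.exists_two_mul_integral_codeLength_le (h : IsMinimalFor Γ e b)
    (hX : ∀ i, Measurable (X i)) (hstat : IsStationaryProcess P X) (henergy : IsFiniteEnergy P X) :
    ∃ C C' : ℝ, 0 ≤ C ∧ ∀ n : ℕ, n ≠ 0 →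
      2 * ∫ ω, ((Γ (block X 0 n ω)).codeLength e b : ℝ) ∂P ≤
        ∫ ω, ((Γ (block X 0 (2 * n) ω)).codeLength e b : ℝ) ∂P +
          C * Real.log (2 * n : ℕ) * ∫ ω, ((Γ (block X 0 (2 * n) ω)).vocab : ℝ) ∂P + C' := by
  obtain ⟨c, K, hc0, hc1, hK, hfe⟩ := henergy.exists_pos hX
  have hlogc : Real.log c < 0 := Real.log_neg hc0 hc1
  -- This makes `c ^ (L + 1) ≤ N ^ (-3)`, so long repeats have probability at most `K / N`. That
  -- offsets the linear code length on the exceptional event and leaves the constant `2 K B`.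
  set A : ℝ := 3 / -Real.log c with hAdef
  have hA : 0 ≤ A := by
    rw [hAdef]
    exact div_nonneg (by norm_num) (by linarith)
  obtain ⟨C, hC, hadd⟩ := h.exists_codeLength_add_le hA
  set B : ℝ := ((b (Fintype.card α + 1)).length : ℝ) with hB
  have hB0 : 0 ≤ B := Nat.cast_nonneg _
  refine ⟨C, 2 * K * B, hC, fun n hn => ?_⟩
  have hn1 : (1 : ℝ) ≤ n := by exact_mod_cast Nat.one_le_iff_ne_zero.2 hn
  set N := 2 * n with hN
  have hNr : (N : ℝ) = 2 * n := by rw [hN]; push_cast; ring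
  set L := ⌈A * Real.log N⌉₊ with hL
  set S : Set Ω := {ω | ¬ ∀ s, IsRepeatedIn s (block X 0 N ω) → s.length ≤ L} with hS
  have hSm : MeasurableSet S :=
    measurableSet_block hX 0 N {w | ¬ ∀ s, IsRepeatedIn s w → s.length ≤ L}
  have hPS : P.real S ≤ K * (N : ℝ)⁻¹ := by
    refine (measureReal_exists_long_repeat_le hX hfe N L).trans ?_
    have hNpos : (0 : ℝ) < N := by rw [hNr]; linarith
    have h1 : c ^ (L + 1) ≤ ((N : ℝ) ^ 3)⁻¹ := by
      rw [← Real.exp_log (show 0 < c ^ (L + 1) by positivity),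
        ← Real.exp_log (show 0 < ((N : ℝ) ^ 3)⁻¹ by positivity), Real.exp_le_exp, Real.log_pow,
        Real.log_inv, Real.log_pow]
      have h2 : A * Real.log N ≤ (L + 1 : ℕ) := by
        push_cast
        linarith [Nat.le_ceil (A * Real.log N)]
      have h3 := mul_le_mul_of_nonpos_right h2 hlogc.le
      have h4 : A * Real.log N * Real.log c = -(3 * Real.log N) := by
        rw [hAdef]
        field_simp [hlogc.ne]
      push_cast at h3 ⊢
      linarith
    calc (N : ℝ) ^ 2 * (K * c ^ (L + 1)) ≤ (N : ℝ) ^ 2 * (K * ((N : ℝ) ^ 3)⁻¹) := by gcongr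
      _ = K * (N : ℝ)⁻¹ := by field_simp
  have hpoint : ∀ ω, ((Γ (block X 0 n ω)).codeLength e b : ℝ)
      + ((Γ (block X (n : ℕ) n ω)).codeLength e b : ℝ) ≤
      (((Γ (block X 0 N ω)).codeLength e b : ℝ) + C * Real.log N * (Γ (block X 0 N ω)).vocab) +
        S.indicator (fun _ => 2 * ((n + 1) * B)) ω := by
    intro ω
    have hsplit : block X 0 N ω = block X 0 n ω ++ block X (n : ℕ) n ω := by
      rw [hN, two_mul, block_add, zero_add]
    have hu := block_ne_nil X 0 hn ω
    have hv := block_ne_nil X (n : ℕ) hn ω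
    have hlogN : 0 ≤ Real.log (N : ℝ) := Real.log_natCast_nonneg N
    by_cases hω : ω ∈ S
    · rw [Set.indicator_of_mem hω]
      have h1 := h.codeLength_le hu
      have h2 := h.codeLength_le hv
      rw [length_block] at h1 h2
      have h1' : ((Γ (block X 0 n ω)).codeLength e b : ℝ) ≤ (n + 1) * B := by
        rw [hB]
        exact_mod_cast h1
      have h2' : ((Γ (block X (n : ℕ) n ω)).codeLength e b : ℝ) ≤ (n + 1) * B := by
        rw [hB]
        exact_mod_cast h2
      have h3 : 0 ≤ ((Γ (block X 0 N ω)).codeLength e b : ℝ)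
          + C * Real.log N * (Γ (block X 0 N ω)).vocab := by positivity
      linarith
    · rw [Set.indicator_of_notMem hω, add_zero]
      have hω' : ∀ s, IsRepeatedIn s (block X 0 N ω) → s.length ≤ L := not_not.1 hω
      have h1 := hadd _ _ hu hv N (by omega) (by rw [← hsplit, length_block])
        (by rw [← hsplit]; exact hω')
      rwa [← hsplit] at h1
  have hint1 := integrable_block (P := P) hX 0 n fun w => ((Γ w).codeLength e b : ℝ)
  have hint2 := integrable_block (P := P) hX (n : ℕ) n fun w => ((Γ w).codeLength e b : ℝ)
  have hint3 := integrable_block (P := P) hX 0 N fun w => ((Γ w).codeLength e b : ℝ)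
  have hint4 := (integrable_block (P := P) hX 0 N fun w => ((Γ w).vocab : ℝ)).const_mul
    (C * Real.log N)
  have hint5 : Integrable (S.indicator fun _ => 2 * ((n + 1) * B)) P :=
    (integrable_const _).indicator hSm
  have hint34 : Integrable (fun ω => ((Γ (block X 0 N ω)).codeLength e b : ℝ) +
      C * Real.log N * (Γ (block X 0 N ω)).vocab) P := hint3.add hint4
  have hmono := integral_mono (hint1.add hint2) (hint34.add hint5) hpoint
  simp only [Pi.add_apply] at hmono
  rw [integral_add hint1 hint2, integral_add hint34 hint5, integral_indicator_const _ hSm,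
    smul_eq_mul, integral_add hint3 hint4, integral_const_mul] at hmono
  have hst : ∫ ω, ((Γ (block X (n : ℕ) n ω)).codeLength e b : ℝ) ∂P =
      ∫ ω, ((Γ (block X 0 n ω)).codeLength e b : ℝ) ∂P :=
    hstat.integral_window hX n n fun x => ((Γ (List.ofFn x)).codeLength e b : ℝ)
  rw [hst] at hmono
  have hlast : P.real S * (2 * ((n + 1) * B)) ≤ 2 * K * B := by
    calc P.real S * (2 * ((n + 1) * B)) ≤ K * (N : ℝ)⁻¹ * (2 * ((n + 1) * B)) := by gcongr
      _ ≤ K * (N : ℝ)⁻¹ * (2 * ((2 * n) * B)) := by gcongr; linarith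
      _ = 2 * K * B := by
        rw [hNr]
        field_simp
  linarith

end Doubling

/-! ### Telescoping of errors and comparison of moments. -/

/-- Telescoping of near superadditivity along powers of two. -/
theorem le_div_two_pow_add_of_two_mul_le {a : ℕ → ℝ} {β η : ℝ} (hβ : β < 1) (hη : 0 ≤ η) {n₀ : ℕ}
    (h : ∀ n, n₀ ≤ n → 2 * a n ≤ a (2 * n) + η * (n : ℝ) ^ β) {n : ℕ} (hn : n₀ ≤ n) (k : ℕ) :
    a n ≤ a (2 ^ k * n) / 2 ^ k + η * (n : ℝ) ^ β / (2 * (1 - 2 ^ (β - 1))) := by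
  have hρ0 : (0 : ℝ) ≤ 2 ^ (β - 1) := by positivity
  have hρ1 : (2 : ℝ) ^ (β - 1) < 1 := Real.rpow_lt_one_of_one_lt_of_neg (by norm_num) (by linarith)
  -- The error at scale `2 ^ k * n`, divided by `2 ^ (k + 1)`, is `η n ^ β / 2` times the `k`-th
  -- power of `2 ^ (β - 1) < 1`: a geometric series.
  have key : ∀ k : ℕ, a n ≤ a (2 ^ k * n) / 2 ^ k +
      η * (n : ℝ) ^ β / 2 * ∑ i ∈ Finset.range k, ((2 : ℝ) ^ (β - 1)) ^ i := by
    intro k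
    induction k with
    | zero => simp
    | succ k ih =>
      have h1 := h (2 ^ k * n) (hn.trans (Nat.le_mul_of_pos_left n (by positivity)))
      have h2 : ((2 ^ k * n : ℕ) : ℝ) ^ β = ((2 : ℝ) ^ (β - 1)) ^ k * 2 ^ k * (n : ℝ) ^ β := by
        push_cast
        rw [Real.mul_rpow (by positivity) (by positivity), ← mul_pow,
          ← Real.rpow_natCast, ← Real.rpow_natCast, ← Real.rpow_mul (by norm_num)]
        congr 1
        have h3 : (2 : ℝ) ^ (β - 1) * 2 = 2 ^ β := by
          rw [Real.rpow_sub_one (by norm_num)]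
          field_simp
        rw [h3, ← Real.rpow_mul (by norm_num), mul_comm]
      have h3 : 2 * (2 ^ k * n) = 2 ^ (k + 1) * n := by ring
      rw [h2, h3] at h1
      have h4 : a (2 ^ k * n) / 2 ^ k ≤ a (2 ^ (k + 1) * n) / 2 ^ (k + 1) +
          η * (n : ℝ) ^ β / 2 * ((2 : ℝ) ^ (β - 1)) ^ k := by
        rw [div_le_iff₀ (by positivity), add_mul]
        have h5 : a (2 ^ (k + 1) * n) / 2 ^ (k + 1) * 2 ^ k = a (2 ^ (k + 1) * n) / 2 := by
          field_simp
          ring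
        rw [h5]
        linarith
      rw [Finset.sum_range_succ, mul_add]
      linarith
  refine (key k).trans ?_
  have h1 : ∑ i ∈ Finset.range k, ((2 : ℝ) ^ (β - 1)) ^ i ≤ (1 - 2 ^ (β - 1))⁻¹ := by
    rw [← tsum_geometric_of_lt_one hρ0 hρ1]
    exact (summable_geometric_of_lt_one hρ0 hρ1).sum_le_tsum _ fun i _ => by positivity
  calc _ ≤ a (2 ^ k * n) / 2 ^ k + η * (n : ℝ) ^ β / 2 * (1 - 2 ^ (β - 1))⁻¹ := by gcongr
    _ = _ := by
      have : (1 : ℝ) - 2 ^ (β - 1) ≠ 0 := by linarith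
      field_simp

/-- Above `ε` the factor `x ^ (1 - p)` is at most `ε ^ (1 - p)`. This pointwise bound passes from
`p`-th to first moments in place of Hölder's inequality. -/
theorem le_add_rpow_of_one_lt {x ε p : ℝ} (hx : 0 ≤ x) (hε : 0 < ε) (hp : 1 < p) :
    x ≤ ε + ε ^ (1 - p) * x ^ p := by
  rcases le_total x ε with h | h
  · have : 0 ≤ ε ^ (1 - p) * x ^ p := by positivity
    linarith
  · have hx0 : 0 < x := hε.trans_le h
    have h1 : x ^ (1 - p) ≤ ε ^ (1 - p) := Real.rpow_le_rpow_of_nonpos hε h (by linarith)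
    have h2 : x = x ^ (1 - p) * x ^ p := by
      rw [← Real.rpow_add hx0]
      simp
    have h3 : x ^ (1 - p) * x ^ p ≤ ε ^ (1 - p) * x ^ p := by gcongr
    linarith

/-! ### The contradiction. -/

section Main

variable {Ω α : Type*} [MeasurableSpace Ω] {P : Measure Ω} [IsProbabilityMeasure P]
  [Fintype α] [MeasurableSpace α] [MeasurableSingletonClass α] {X : ℤ → Ω → α}
  {Γ : List α → AdmissibleGrammar α} {e : α ≃ Fin (Fintype.card α)} {b : ℕ → List Bool}
  {Z : ℕ → Ω → Bool} {s : ℕ → List α → Bool}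

/-- If the `p`-th moments of the normalized vocabulary size tend to zero, then so does the
normalized expected vocabulary size. -/
theorem eventually_integral_vocab_le (hX : ∀ i, Measurable (X i)) {β p : ℝ} (hp : 1 < p)
    (hlim : limsup (fun n : ℕ => ∫⁻ ω, ENNReal.ofReal
      ((((Γ (block X 0 n ω)).vocab : ℝ) / ((n : ℝ) ^ β * (Real.log n)⁻¹)) ^ p) ∂P) atTop = 0)
    {ε : ℝ} (hε : 0 < ε) :
    ∀ᶠ n : ℕ in atTop,
      Real.log n * ∫ ω, ((Γ (block X 0 n ω)).vocab : ℝ) ∂P ≤ ε * (n : ℝ) ^ β := by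
  -- With `p`-th moments below `(ε / 2) ^ p`, the factor `(ε / 2) ^ (1 - p)` leaves `ε / 2`, so both
  -- terms of the moment comparison are at most `ε / 2`.
  have hε2 : 0 < ε / 2 := by positivity
  have hη : 0 < (ε / 2) ^ p := by positivity
  have h1 := eventually_lt_of_limsup_lt
    (lt_of_eq_of_lt hlim (ENNReal.ofReal_pos.2 hη))
  filter_upwards [h1, eventually_ge_atTop 2] with n hn hn2
  have hn2' : (2 : ℝ) ≤ n := by exact_mod_cast hn2
  have hlog : 0 < Real.log n := Real.log_pos (by linarith)
  have hnβ : (0 : ℝ) < (n : ℝ) ^ β := by positivity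
  set D : ℝ := (n : ℝ) ^ β * (Real.log n)⁻¹ with hD
  have hD0 : 0 < D := by positivity
  have hint := integrable_block (P := P) hX 0 n fun w => (((Γ w).vocab : ℝ) / D) ^ p
  have hint' := integrable_block (P := P) hX 0 n fun w => ((Γ w).vocab : ℝ) / D
  rw [← ofReal_integral_eq_lintegral_ofReal hint (Eventually.of_forall fun ω => by positivity),
    ENNReal.ofReal_lt_ofReal_iff hη] at hn
  have h2 : ∫ ω, ((Γ (block X 0 n ω)).vocab : ℝ) / D ∂P ≤
      ε / 2 + (ε / 2) ^ (1 - p) * ∫ ω, (((Γ (block X 0 n ω)).vocab : ℝ) / D) ^ p ∂P := by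
    have h3 := integral_mono hint' ((integrable_const (ε / 2)).add
      (hint.const_mul ((ε / 2) ^ (1 - p))))
      fun ω => le_add_rpow_of_one_lt (x := ((Γ (block X 0 n ω)).vocab : ℝ) / D) (by positivity)
        hε2 hp
    simp only [Pi.add_apply] at h3
    rwa [integral_add (integrable_const _) (hint.const_mul _), integral_const, probReal_univ,
      one_smul, integral_const_mul] at h3
  have h3 : (ε / 2) ^ (1 - p) * ∫ ω, (((Γ (block X 0 n ω)).vocab : ℝ) / D) ^ p ∂P ≤ ε / 2 := by
    calc _ ≤ (ε / 2) ^ (1 - p) * (ε / 2) ^ p := by gcongr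
      _ = ε / 2 := by rw [← Real.rpow_add hε2]; simp
  rw [integral_div] at h2
  have h4 : (∫ ω, ((Γ (block X 0 n ω)).vocab : ℝ) ∂P) / D ≤ ε := by linarith
  rw [div_le_iff₀ hD0] at h4
  calc Real.log n * ∫ ω, ((Γ (block X 0 n ω)).vocab : ℝ) ∂P ≤ Real.log n * (ε * D) := by gcongr
    _ = ε * (n : ℝ) ^ β := by
      rw [hD]
      field_simp

/-- The dictionary bound is applied at length `2 ^ (i + j) * n`, with `2 ^ i` sequences of `2 ^ j`
blocks, and divided by `2 ^ (i + j)`. Letting `i`, then `j`, tend to infinity and then `ε` to 0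
removes all but the entropy and `R`. -/
theorem codeLength_le_of_two_mul_le (h : IsMinimalFor Γ e b) (hX : ∀ i, Measurable (X i))
    (hstat : IsStationaryProcess P X) (hZ : IsStronglyNonergodicWith P X Z s) (F : Finset ℕ)
    {n : ℕ} (hn : n ≠ 0) {R : ℝ}
    (hR : ∀ k : ℕ, ∫ ω, ((Γ (block X 0 n ω)).codeLength e b : ℝ) ∂P ≤
      (∫ ω, ((Γ (block X 0 (2 ^ k * n) ω)).codeLength e b : ℝ) ∂P) / 2 ^ k + R) :
    Real.log 2 * ∫ ω, ((Γ (block X 0 n ω)).codeLength e b : ℝ) ∂P ≤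
      entropyGiven P X Z F n + Real.log 2 * R := by
  have hlog2 : 0 < Real.log 2 := Real.log_pos (by norm_num)
  set H := entropyGiven P X Z F n
  set a := Real.log 2 * ∫ ω, ((Γ (block X 0 n ω)).codeLength e b : ℝ) ∂P with ha
  have hpow : ∀ C : ℝ, Tendsto (fun i : ℕ => C / (2 : ℝ) ^ i) atTop (𝓝 0) := fun C =>
    (tendsto_pow_atTop_atTop_of_one_lt (by norm_num : (1 : ℝ) < 2)).const_div_atTop C
  have h1 : ∀ ε : ℝ, 0 < ε → a ≤ (1 + ε) * H + Real.log 2 * R := by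
    intro ε hε
    obtain ⟨C, hC⟩ := codeLength_le_entropyGiven h hX hstat hZ hε F hn
    have h2 : ∀ j : ℕ, a ≤ (1 + ε) * H + Real.log 2 * R + C / 2 ^ j := by
      intro j
      obtain ⟨C', hC'⟩ := hC (2 ^ j) (by positivity)
      have h3 : ∀ i : ℕ, a ≤ (1 + ε) * H + Real.log 2 * R + C / 2 ^ j + C' / 2 ^ j / 2 ^ i := by
        intro i
        have h4 := hC' (2 ^ i) (by positivity)
        have h5 := mul_le_mul_of_nonneg_left (hR (i + j)) hlog2.le
        have h6 : 2 ^ (i + j) * n = 2 ^ i * (2 ^ j * n) := by ring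
        rw [h6, ← ha, mul_add, ← mul_div_assoc] at h5
        have h7 := div_le_div_of_nonneg_right h4 (show (0 : ℝ) ≤ 2 ^ (i + j) by positivity)
        have h8 : (((2 ^ i : ℕ) : ℝ) * ((1 + ε) * (((2 ^ j : ℕ) : ℝ) * H) + C) + C') / 2 ^ (i + j) =
            (1 + ε) * H + C / 2 ^ j + C' / 2 ^ j / 2 ^ i := by
          push_cast
          rw [pow_add]
          field_simp
        rw [h8] at h7
        linarith
      have h4 := (hpow (C' / 2 ^ j)).const_add ((1 + ε) * H + Real.log 2 * R + C / 2 ^ j)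
      rw [add_zero] at h4
      exact ge_of_tendsto' h4 h3
    have h4 := (hpow C).const_add ((1 + ε) * H + Real.log 2 * R)
    rw [add_zero] at h4
    exact ge_of_tendsto' h4 h2
  have h2 : Tendsto (fun i : ℕ => (1 + 1 / ((i : ℝ) + 1)) * H + Real.log 2 * R) atTop
      (𝓝 ((1 + 0) * H + Real.log 2 * R)) :=
    ((tendsto_one_div_add_atTop_nhds_zero_nat.const_add 1).mul_const H).add_const _
  rw [add_zero, one_mul] at h2
  exact ge_of_tendsto' h2 fun i => h1 _ (by positivity)

/-- A lower bound on the growth of a sequence of sets of natural numbers yields finite subsets. -/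
theorem exists_finset_of_liminf_pos {U : ℕ → Set ℕ} {β : ℝ}
    (hU : 0 < liminf (fun n : ℕ => ((U n).encard : ℝ≥0∞) / ENNReal.ofReal ((n : ℝ) ^ β)) atTop) :
    ∃ c : ℝ, 0 < c ∧ ∀ᶠ n : ℕ in atTop, ∃ F : Finset ℕ, (∀ k ∈ F, k ∈ U n) ∧
      c * (n : ℝ) ^ β ≤ F.card := by
  obtain ⟨c, hc0, hc⟩ := ENNReal.lt_iff_exists_nnreal_btwn.1 hU
  refine ⟨c, by exact_mod_cast hc0, ?_⟩
  filter_upwards [eventually_lt_of_lt_liminf hc, eventually_ge_atTop 1] with n hn hn1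
  have hn1' : (1 : ℝ) ≤ n := by exact_mod_cast hn1
  have hnβ : (0 : ℝ) < (n : ℝ) ^ β := by positivity
  have h1 : (c : ℝ≥0∞) * ENNReal.ofReal ((n : ℝ) ^ β) ≤ ((U n).encard : ℝ≥0∞) :=
    (ENNReal.le_div_iff_mul_le (Or.inl (by simpa using hnβ)) (Or.inl ENNReal.ofReal_ne_top)).1 hn.le
  have h2 : ((⌈(c : ℝ) * (n : ℝ) ^ β⌉₊ : ℕ) : ℕ∞) ≤ (U n).encard := by
    rcases eq_or_ne (U n).encard ⊤ with htop | htop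
    · rw [htop]
      exact le_top
    · obtain ⟨j, hj⟩ := ENat.ne_top_iff_exists.1 htop
      rw [← hj] at h1 ⊢
      rw [Nat.cast_le, Nat.ceil_le]
      rw [← ENNReal.ofReal_coe_nnreal, ← ENNReal.ofReal_mul c.coe_nonneg] at h1
      simp only [ENat.toENNReal_coe] at h1
      rwa [← ENNReal.ofReal_natCast, ENNReal.ofReal_le_ofReal_iff (Nat.cast_nonneg _)] at h1
  obtain ⟨t, ht, htc⟩ := Set.exists_subset_encard_eq h2
  have hfin : t.Finite := Set.finite_of_encard_eq_coe htc
  refine ⟨hfin.toFinset, fun k hk => ht (hfin.mem_toFinset.1 hk), ?_⟩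
  rw [hfin.encard_eq_coe_toFinset_card, Nat.cast_inj] at htc
  rw [htc]
  exact Nat.le_ceil _

end Main

theorem theorem1 {Ω α : Type*} [MeasurableSpace Ω] (P : Measure Ω) [IsProbabilityMeasure P]
    [Fintype α] [MeasurableSpace α] [MeasurableSingletonClass α]
    (X : ℤ → Ω → α) (hX : ∀ i, Measurable (X i))
    (hstat : IsStationaryProcess P X) (henergy : IsFiniteEnergy P X)
    (Z : ℕ → Ω → Bool) (s : ℕ → List α → Bool) (hZ : IsStronglyNonergodicWith P X Z s)
    (β δ : ℝ) (hβ : β ∈ Set.Ioo (0 : ℝ) 1) (hδ : δ ∈ Set.Ioo (1 / 2 : ℝ) 1)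
    (hU : 0 < liminf (fun n : ℕ =>
      ((predictableFacts P X Z s δ n).encard : ℝ≥0∞) / ENNReal.ofReal ((n : ℝ) ^ β)) atTop)
    (p : ℝ) (hp : 1 < p)
    (Γ : List α → AdmissibleGrammar α) (hΓ : IsAdmissiblyMinimal Γ) :
    0 < limsup (fun n : ℕ =>
      ∫⁻ ω, ENNReal.ofReal
        ((((Γ (block X 0 n ω)).vocab : ℝ) / ((n : ℝ) ^ β * (Real.log n)⁻¹)) ^ p) ∂P) atTop := by
  by_contra hcon
  have hlim := nonpos_iff_eq_zero.1 (not_lt.1 hcon)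
  obtain ⟨htrans, e, b, hb, hmin⟩ := hΓ
  have h : IsMinimalFor Γ e b := ⟨hb, htrans, hmin⟩
  obtain ⟨hβ0, hβ1⟩ := hβ
  have hlog2 : 0 < Real.log 2 := Real.log_pos (by norm_num)
  have hκ : 0 < Real.log 2 - Real.binEntropy δ :=
    sub_pos.2 (Real.binEntropy_lt_log_two.2 (by have := hδ.1; norm_num at this ⊢; exact this.ne'))
  have hρ1 : (2 : ℝ) ^ (β - 1) < 1 := Real.rpow_lt_one_of_one_lt_of_neg (by norm_num) (by linarith)
  obtain ⟨c, hc, hF⟩ := exists_finset_of_liminf_pos hU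
  obtain ⟨C, C', hC, hdouble⟩ := h.exists_two_mul_integral_codeLength_le hX hstat henergy
  set M : ℝ := 2 * (1 - 2 ^ (β - 1)) with hM
  have hM0 : 0 < M := by rw [hM]; linarith
  set κ := Real.log 2 - Real.binEntropy δ
  -- Chosen so that the telescoped error, times `log 2`, is half of `κ c n ^ β`. In `2 * C + 1` the
  -- term `2 * C` comes from `(2n) ^ β ≤ 2 n ^ β` and the 1 from absorbing `C'`; `M` is the
  -- denominator of the geometric series.
  set ε : ℝ := κ * c * M / (2 * Real.log 2 * (2 * C + 1)) with hε
  have hε0 : 0 < ε := by positivity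
  have hvocab := eventually_integral_vocab_le hX hp hlim hε0
  have hpow : ∀ᶠ n : ℕ in atTop, C' ≤ ε * (n : ℝ) ^ β :=
    (((tendsto_rpow_atTop hβ0).comp tendsto_natCast_atTop_atTop).const_mul_atTop
      hε0).eventually_ge_atTop C'
  have hdouble' : ∀ᶠ n : ℕ in atTop, 2 * ∫ ω, ((Γ (block X 0 n ω)).codeLength e b : ℝ) ∂P ≤
      ∫ ω, ((Γ (block X 0 (2 * n) ω)).codeLength e b : ℝ) ∂P
        + (2 * C + 1) * ε * (n : ℝ) ^ β := by
    have htwo : Tendsto (fun n : ℕ => 2 * n) atTop atTop :=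
      tendsto_id.const_mul_atTop' (by norm_num)
    filter_upwards [htwo.eventually hvocab, hpow, eventually_ge_atTop 1] with n hn1 hn2 hn3
    have h1 := hdouble n (by omega)
    have h2 : ((2 * n : ℕ) : ℝ) ^ β ≤ 2 * (n : ℝ) ^ β := by
      push_cast
      rw [Real.mul_rpow (by norm_num) (by positivity)]
      have : (2 : ℝ) ^ β ≤ 2 := by
        conv_rhs => rw [← Real.rpow_one 2]
        exact Real.rpow_le_rpow_of_exponent_le (by norm_num) hβ1.le
      gcongr
    have h3 := mul_le_mul_of_nonneg_left (hn1.trans (mul_le_mul_of_nonneg_left h2 hε0.le)) hC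
    rw [← mul_assoc] at h3
    linarith
  obtain ⟨n₀, hn₀⟩ := eventually_atTop.1 hdouble'
  obtain ⟨n, ⟨F, hFU, hFc⟩, hn1, hn⟩ :=
    (hF.and ((eventually_ge_atTop 1).and (eventually_ge_atTop n₀))).exists
  have hn0 : n ≠ 0 := by omega
  have hnβ : (0 : ℝ) < (n : ℝ) ^ β := by
    have : (1 : ℝ) ≤ n := by exact_mod_cast hn1
    positivity
  have hlow := entropyGiven_add_le h hX hZ hδ F hn0 hFU
  have htel := le_div_two_pow_add_of_two_mul_le
    (a := fun n => ∫ ω, ((Γ (block X 0 n ω)).codeLength e b : ℝ) ∂P) hβ1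
    (show 0 ≤ (2 * C + 1) * ε by positivity) hn₀ hn
  have hup := codeLength_le_of_two_mul_le h hX hstat hZ F hn0 htel
  have h1 : c * (n : ℝ) ^ β * κ ≤ F.card * κ := by gcongr
  have h2 : Real.log 2 * ((2 * C + 1) * ε * (n : ℝ) ^ β / M) = κ * c * (n : ℝ) ^ β / 2 := by
    rw [hε]
    field_simp
  have h3 : 0 < κ * c * (n : ℝ) ^ β := by positivity
  rw [← hM] at hup
  linarith
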